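/- Let $R$ be a real random variable with $\mathbb{E}R=0$ and $\mathbb{E}R^2=1$, and let $R_1,R_2,\dots$ be independent copies of $R$. For every $d\in\mathbb{N}$ let $V_1^{(d)},V_2^{(d)},\dots$ be i.i.d. random vectors uniformly distributed on the standard basis $\{e_1,\dots,e_d\}$ of $\mathbb{R}^d$, with $(R_i)_{i\ge1}$ and $(V_i^{(d)})_{i\ge1}$ independent. Put $S_n^{(d)}=\sum_{i=1}^n R_iV_i^{(d)}$, let $n=n(d)$ be any sequence of positive integers with $n(d)\to\infty$ as $d\to\infty$, and let $\|\cdot\|$ be the Euclidean norm. Below, $\Rightarrow$ denotes convergence in distribution as $d\to\infty$, and $\mathrm{N}(0,\sigma^2)$ the centered normal law with variance $\sigma^2$ (the unit mass at $0$ if $\sigma^2=0$). (I) Suppose that $\mathbb{E}R^4<\infty$. (a) If $n/d\to0$, then $\dfrac{\|S_n^{(d)}\|^2-n}{\sqrt n}\Rightarrow \mathrm{N}(0,\operatorname{Var}(R^2))$. (b) If $n/d\to\infty$, then $\dfrac{\|S_n^{(d)}\|^2-n}{\sqrt{2n^2/d}}\Rightarrow \mathrm{N}(0,1)$. (c) If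 $n\sim\gamma d$ for some constant $\gamma\in(0,\infty)$, then $\dfrac{\|S_n^{(d)}\|^2-n}{\sqrt n}\Rightarrow \mathrm{N}(0,2\gamma+\operatorname{Var}(R^2))$. (II) Suppose instead that, for some $\alpha\in(1,2)$, some function $L$ slowly varying at infinity and some zero-mean random variable $\zeta_\alpha$ with a spectrally positive $\alpha$-stable distribution (that is, for some $\sigma>0$, $\mathbb{E}e^{it\zeta_\alpha}=\exp\bigl(-\sigma^\alpha|t|^\alpha(1-i\,\mathrm{sgn}(t)\tan\tfrac{\pi\alpha}{2})\bigr)$ for all $t\in\mathbb{R}$), the random variables $\dfrac{R_1^2+\dots+R_m^2-m}{m^{1/\alpha}L(m)}$ converge in distribution to $\zeta_\alpha$ as $m\to\infty$. (a) If there is $\delta>0$ such that $n>d^{\frac{\alpha}{2\alpha-2}+\delta}$ for all sufficiently large $d$, then $\dfrac{\|S_n^{(d)}\|^2-n}{\sqrt{2n^2/d}}\Rightarrow \mathrm{N}(0,1)$. (b) If there is $\delta>0$ such that $n<d^{\frac{\alpha}{2\alpha-2}-\delta}$ for all sufficiently large $d$, then $\dfrac{\|S_n^{(d)}\|^2-n}{n^{1/\alpha}L(n)}\Rightarrow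 \zeta_\alpha$. -/

import Mathlib

open MeasureTheory ProbabilityTheory Filter Topology Asymptotics

noncomputable section

/-- The random walk jumping along the coordinate axes. For every dimension `d` the increments are
`R i • V d i`, where `R 0, R 1, …` are independent copies of a real random variable `R₀` with
`E R₀ = 0`, `E R₀² = 1`, the vectors `V d 0, V d 1, …` are i.i.d. and uniformly distributed on the
standard basis of `ℝ^d`, and the two sequences are independent.
(As `E R₀² = 1 ≠ 0`, the variable `R₀` is automatically square integrable, hence integrable.) -/
structure IsAxisWalkModel {Ω₀ Ω : Type*} [MeasurableSpace Ω₀] [MeasurableSpace Ω]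
    (P₀ : Measure Ω₀) (P : Measure Ω) (R₀ : Ω₀ → ℝ) (R : ℕ → Ω → ℝ)
    (V : (d : ℕ) → ℕ → Ω → EuclideanSpace ℝ (Fin d)) : Prop where
  mean_zero : ∫ ω, R₀ ω ∂P₀ = 0
  second_moment : ∫ ω, R₀ ω ^ 2 ∂P₀ = 1
  measurable_R : ∀ i, Measurable (R i)
  identDistrib_R : ∀ i, IdentDistrib (R i) R₀ P P₀
  indep_R : iIndepFun R P
  measurable_V : ∀ d i, Measurable (V d i)
  uniform_V : ∀ (d i : ℕ) (j : Fin d),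
    P {ω | V d i ω = EuclideanSpace.single j (1 : ℝ)} = (d : ENNReal)⁻¹
  indep_V : ∀ d, iIndepFun (V d) P
  indep_R_V : ∀ d, IndepFun (fun ω i => R i ω) (fun ω i => V d i ω) P

/-- The position `S_n^{(d)}` after `n` steps. -/
def axisWalk {Ω : Type*} (R : ℕ → Ω → ℝ) (V : (d : ℕ) → ℕ → Ω → EuclideanSpace ℝ (Fin d))
    (d n : ℕ) (ω : Ω) : EuclideanSpace ℝ (Fin d) :=
  ∑ i ∈ Finset.range n, R i ω • V d i ω

/-- The random variables `X m` on `(Ω, P)` converge in distribution to the probability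
law `ν` as `m → ∞`. -/
def ConvergesInLaw {Ω : Type*} [MeasurableSpace Ω] (P : Measure Ω) [IsProbabilityMeasure P]
    (X : ℕ → Ω → ℝ) (ν : Measure ℝ) [IsProbabilityMeasure ν] : Prop :=
  TendstoInDistribution (Ω := fun _ => Ω) X atTop (id : ℝ → ℝ) (fun _ => P) ν

/-- `L` is slowly varying at infinity. -/
structure IsSlowlyVarying (L : ℝ → ℝ) : Prop where
  measurable : Measurable L
  eventually_pos : ∀ᶠ x in atTop, 0 < L x
  tendsto_ratio : ∀ c : ℝ, 0 < c → Tendsto (fun x => L (c * x) / L x) atTop (𝓝 1)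

/-- For `α ∈ (1, 2)`: `ν` is a zero-mean spectrally positive `α`-stable law, that is, the stable
law with index `α`, some scale `σ > 0`, skewness `1` and location (mean) `0`. -/
def IsCenteredSpectrallyPositiveStable (α : ℝ) (ν : Measure ℝ) : Prop :=
  ∃ σ : ℝ, 0 < σ ∧ ∀ t : ℝ, charFun ν t =
    Complex.exp (-(((σ * |t|) ^ α : ℝ) : ℂ) *
      (1 - Complex.I * ((Real.sign t * Real.tan (Real.pi * α / 2) : ℝ) : ℂ)))

end

/-!
Almost surely `‖S_n‖² - n = ∑ (R_k² - 1) + 2 ∑ R_k ⟪S_k, V_k⟫`, where `S_k` is the position before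
step `k` (indexed from `0`), and both sums are martingales. The first is a sum of i.i.d. variables;
the second has variance of order `n² / d` and only sees the first two moments of `R` in the limit.
A quantitative martingale central limit theorem, which compares characteristic functions one
increment at a time, handles `∑ (a (g R_k) + b R_k ⟪S_k, V_k⟫)` for every `g` with `E g(R) = 0`
when the summands have four moments. Truncating `R` and `g R`, with an error that is small in `L²`
uniformly in `d`, extends this to finite second moments and so gives the three Gaussian regimes
with fourth moments. In the stable case the first sum has order `n^(1/α) L(n)`. Since a slowly
varying `L` is `x^(o(1))`, which of `n^(1/α) L(n)` and `n / √d` dominates is decided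
by comparing `n` with `d^(α / (2α - 2))`, and the other sum is negligible in probability.
-/

noncomputable section

section MartingaleCLT

variable {Ω : Type*} {m mΩ : MeasurableSpace Ω} {P : Measure Ω}

lemma norm_exp_mul_I_sub_taylor_two_le (x : ℝ) :
    ‖Complex.exp (x * Complex.I) - (1 + x * Complex.I - x ^ 2 / 2)‖ ≤ 4 * |x| ^ 3 := by
  rcases le_total |x| 1 with h | h
  · have hexp := Complex.norm_exp_sub_sum_le_norm_mul_exp (x * Complex.I) 3
    have hsum : ∑ i ∈ Finset.range 3, (x * Complex.I) ^ i / (i.factorial : ℂ) =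
        1 + x * Complex.I - x ^ 2 / 2 := by
      simp only [Finset.sum_range_succ, Finset.sum_range_zero, mul_pow, Complex.I_sq]
      norm_num [Nat.factorial]
      ring
    have hnorm : ‖(x : ℂ) * Complex.I‖ = |x| := by simp
    rw [hsum, hnorm] at hexp
    have he : Real.exp |x| ≤ 4 :=
      (Real.exp_le_exp.2 h).trans (Real.exp_one_lt_d9.le.trans (by norm_num))
    nlinarith [pow_nonneg (abs_nonneg x) 3]
  · calc ‖Complex.exp (x * Complex.I) - (1 + x * Complex.I - x ^ 2 / 2)‖
        ≤ ‖Complex.exp (x * Complex.I)‖ + (‖(1 : ℂ)‖ + ‖x * Complex.I‖ + ‖(x : ℂ) ^ 2 / 2‖) :=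
          (norm_sub_le _ _).trans (add_le_add_right
            ((norm_sub_le _ _).trans (add_le_add_left (norm_add_le _ _) _)) _)
      _ = 1 + (1 + |x| + |x| ^ 2 / 2) := by simp [Complex.norm_exp_ofReal_mul_I]
      _ ≤ 4 * |x| ^ 3 := by
        nlinarith [pow_le_pow_left₀ zero_le_one h 2, pow_nonneg (abs_nonneg x) 2]

lemma abs_exp_neg_sub_one_sub_le {x : ℝ} (hx : 0 ≤ x) :
    |Real.exp (-x) - (1 - x)| ≤ x ^ 2 / 2 := by
  have hlow := Real.add_one_le_exp (-x)
  have hupp := Real.quadratic_le_exp_of_nonneg hx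
  have hinv : Real.exp (-x) * Real.exp x = 1 := by rw [← Real.exp_add]; simp
  rw [abs_le]
  constructor
  · nlinarith [sq_nonneg x]
  · nlinarith [mul_le_mul_of_nonneg_left hupp (Real.exp_nonneg (-x)), Real.exp_nonneg (-x),
      pow_nonneg hx 3, pow_nonneg hx 4, mul_nonneg hx hx]

lemma integral_abs_mul_le_sqrt_mul_sqrt {X Y : Ω → ℝ} (hX : MemLp X 2 P) (hY : MemLp Y 2 P) :
    ∫ ω, |X ω * Y ω| ∂P ≤ √(∫ ω, X ω ^ 2 ∂P) * √(∫ ω, Y ω ^ 2 ∂P) := by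
  have h := integral_mul_le_Lp_mul_Lq_of_nonneg (μ := P) Real.HolderConjugate.two_two
    (ae_of_all _ fun ω => abs_nonneg (X ω)) (ae_of_all _ fun ω => abs_nonneg (Y ω))
    (by simpa using hX.norm) (by simpa using hY.norm)
  simpa [abs_mul, Real.sqrt_eq_rpow] using h

lemma integral_abs_le_sqrt [IsProbabilityMeasure P] {X : Ω → ℝ} (hX : MemLp X 2 P) :
    ∫ ω, |X ω| ∂P ≤ √(∫ ω, X ω ^ 2 ∂P) := by
  simpa using integral_abs_mul_le_sqrt_mul_sqrt hX (memLp_const (1 : ℝ))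

lemma integrable_abs_pow_iff_memLp {X : Ω → ℝ} (hX : AEStronglyMeasurable X P) {p : ℕ}
    (hp : p ≠ 0) : Integrable (fun ω => |X ω| ^ p) P ↔ MemLp X p P := by
  simpa using integrable_norm_rpow_iff hX (p := (p : ENNReal)) (by simpa using hp) (by simp)

lemma memLp_four_iff_integrable_pow {X : Ω → ℝ} (hX : AEStronglyMeasurable X P) :
    MemLp X 4 P ↔ Integrable (fun ω => X ω ^ 4) P := by
  simpa [Even.pow_abs ⟨2, rfl⟩] using (integrable_abs_pow_iff_memLp hX four_ne_zero).symm

lemma memLp_two_sq_of_memLp_four {X : Ω → ℝ} (hX : MemLp X 4 P) :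
    MemLp (fun ω => X ω ^ 2) 2 P := by
  rw [memLp_two_iff_integrable_sq (by exact hX.1.pow 2)]
  simpa only [← pow_mul] using (memLp_four_iff_integrable_pow hX.1).1 hX

lemma integral_abs_pow_three_le [IsFiniteMeasure P] {X : Ω → ℝ} (hX : MemLp X 4 P) :
    ∫ ω, |X ω| ^ 3 ∂P ≤ √(∫ ω, X ω ^ 2 ∂P) * √(∫ ω, X ω ^ 4 ∂P) := by
  have h := integral_abs_mul_le_sqrt_mul_sqrt (hX.mono_exponent (by norm_num))
    (memLp_two_sq_of_memLp_four hX)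
  simpa only [abs_mul, abs_pow, ← pow_succ', ← pow_mul, Nat.reduceMul, Nat.reduceAdd] using h

lemma sq_integral_sq_le [IsProbabilityMeasure P] {X : Ω → ℝ} (hX : MemLp X 4 P) :
    (∫ ω, X ω ^ 2 ∂P) ^ 2 ≤ ∫ ω, X ω ^ 4 ∂P := by
  have h := integral_abs_le_sqrt (memLp_two_sq_of_memLp_four hX)
  simp only [abs_sq, ← pow_mul, Nat.reduceMul] at h
  exact (Real.le_sqrt (integral_nonneg fun ω => sq_nonneg (X ω))
    (integral_nonneg fun ω => by positivity)).1 h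

lemma norm_integral_mul_le_integral_abs_condExp [IsFiniteMeasure P] (hm : m ≤ mΩ) {Z : Ω → ℂ}
    (hZ : StronglyMeasurable[m] Z) (hZ1 : ∀ ω, ‖Z ω‖ ≤ 1) {Y : Ω → ℝ} (hY : Integrable Y P) :
    ‖∫ ω, Z ω * (Y ω : ℂ) ∂P‖ ≤ ∫ ω, |P[Y | m] ω| ∂P := by
  have hZY : Integrable (fun ω => Z ω * (Y ω : ℂ)) P :=
    hY.ofReal.bdd_mul (hZ.mono hm).aestronglyMeasurable (ae_of_all _ hZ1)
  have hpull : P[fun ω => Z ω * (Y ω : ℂ) | m] =ᵐ[P] fun ω => Z ω * (P[Y | m] ω : ℂ) := by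
    have := condExp_bilin_of_stronglyMeasurable_left
      (ContinuousLinearMap.lsmul ℝ ℝ : ℝ →L[ℝ] ℂ →L[ℝ] ℂ).flip hZ
      (by simpa [mul_comm] using hZY) hY
    simpa [mul_comm] using this
  rw [← integral_condExp hm, integral_congr_ae hpull]
  refine (norm_integral_le_integral_norm _).trans
    (integral_mono_of_nonneg (ae_of_all _ fun _ => norm_nonneg _) integrable_condExp.abs
      (ae_of_all _ fun ω => ?_))
  simpa using mul_le_mul_of_nonneg_right (hZ1 ω) (abs_nonneg (P[Y | m] ω))

lemma norm_exp_mul_I_sub_exp_neg_sub_le (x : ℝ) {v : ℝ} (hv : 0 ≤ v) :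
    ‖Complex.exp (x * Complex.I) - Real.exp (-(v / 2)) -
        (x * Complex.I - ((x ^ 2 - v : ℝ) : ℂ) / 2)‖ ≤ 4 * |x| ^ 3 + v ^ 2 / 8 := by
  have hsplit : Complex.exp (x * Complex.I) - Real.exp (-(v / 2)) -
      (x * Complex.I - ((x ^ 2 - v : ℝ) : ℂ) / 2) =
      (Complex.exp (x * Complex.I) - (1 + x * Complex.I - x ^ 2 / 2)) -
        ((Real.exp (-(v / 2)) - (1 - v / 2) : ℝ) : ℂ) := by
    push_cast
    ring
  rw [hsplit]
  refine (norm_sub_le _ _).trans (add_le_add (norm_exp_mul_I_sub_taylor_two_le x) ?_)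
  rw [Complex.norm_real]
  exact (abs_exp_neg_sub_one_sub_le (by positivity)).trans_eq (by ring)

lemma integral_mul_eq_zero_of_condExp_eq_zero [IsFiniteMeasure P] (hm : m ≤ mΩ) {Z : Ω → ℂ}
    (hZ : StronglyMeasurable[m] Z) (hZ1 : ∀ ω, ‖Z ω‖ ≤ 1) {Y : Ω → ℝ} (hY : Integrable Y P)
    (hY0 : P[Y | m] =ᵐ[P] 0) : ∫ ω, Z ω * (Y ω : ℂ) ∂P = 0 := by
  have hzero : ∫ ω, |P[Y | m] ω| ∂P = 0 :=
    integral_eq_zero_of_ae (hY0.mono fun ω hω => by simp [hω])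
  simpa [hzero] using norm_integral_mul_le_integral_abs_condExp hm hZ hZ1 hY

lemma norm_integral_mul_le_integral_of_norm_le {Z Y : Ω → ℂ} (hZ1 : ∀ ω, ‖Z ω‖ ≤ 1) {b : Ω → ℝ}
    (hb : Integrable b P) (hY : ∀ ω, ‖Y ω‖ ≤ b ω) : ‖∫ ω, Z ω * Y ω ∂P‖ ≤ ∫ ω, b ω ∂P :=
  norm_integral_le_of_norm_le hb (ae_of_all _ fun ω =>
    (norm_mul_le _ _).trans ((mul_le_of_le_one_left (norm_nonneg _) (hZ1 ω)).trans (hY ω)))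

lemma norm_integral_mul_exp_sub_le [IsProbabilityMeasure P] (hm : m ≤ mΩ) {Z : Ω → ℂ}
    (hZ : StronglyMeasurable[m] Z) (hZ1 : ∀ ω, ‖Z ω‖ ≤ 1) {X : Ω → ℝ} (hX : MemLp X 3 P)
    (hX0 : P[X | m] =ᵐ[P] 0) {v : ℝ} (hv : 0 ≤ v) :
    ‖∫ ω, Z ω * (Complex.exp (X ω * Complex.I) - Real.exp (-(v / 2))) ∂P‖ ≤
      (∫ ω, |P[fun ω => X ω ^ 2 - v | m] ω| ∂P) / 2 + (4 * ∫ ω, |X ω| ^ 3 ∂P + v ^ 2 / 8) := by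
  set r : Ω → ℂ := fun ω => Complex.exp (X ω * Complex.I) - Real.exp (-(v / 2)) -
    (X ω * Complex.I - ((X ω ^ 2 - v : ℝ) : ℂ) / 2)
  have hX1 : Integrable X P := hX.integrable (by norm_num)
  have hX2 : Integrable (fun ω => X ω ^ 2 - v) P :=
    (hX.mono_exponent (by norm_num)).integrable_sq.sub (integrable_const v)
  have hX3 : Integrable (fun ω => |X ω| ^ 3) P :=
    (integrable_abs_pow_iff_memLp hX.1 three_ne_zero).2 hX
  have hr_le (ω : Ω) : ‖r ω‖ ≤ 4 * |X ω| ^ 3 + v ^ 2 / 8 :=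
    norm_exp_mul_I_sub_exp_neg_sub_le (X ω) hv
  have hr_bound : Integrable (fun ω => 4 * |X ω| ^ 3 + v ^ 2 / 8) P :=
    (hX3.const_mul 4).add (integrable_const _)
  have hr : Integrable r P := by
    have := hX.1.aemeasurable
    exact hr_bound.mono' (AEMeasurable.aestronglyMeasurable (by fun_prop)) (ae_of_all _ hr_le)
  have hmul {Y : Ω → ℂ} (hY : Integrable Y P) : Integrable (fun ω => Z ω * Y ω) P :=
    hY.bdd_mul (hZ.mono hm).aestronglyMeasurable (ae_of_all _ hZ1)
  have hsplit : ∫ ω, Z ω * (Complex.exp (X ω * Complex.I) - Real.exp (-(v / 2))) ∂P =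
      ∫ ω, Z ω * r ω ∂P - (∫ ω, Z ω * ((X ω ^ 2 - v : ℝ) : ℂ) ∂P) / 2 := by
    have hr' := hmul hr
    have hX1' : Integrable (fun ω => Complex.I * (Z ω * (X ω : ℂ))) P :=
      (hmul hX1.ofReal).const_mul _
    have hX2' : Integrable (fun ω => Z ω * ((X ω ^ 2 - v : ℝ) : ℂ) / 2) P :=
      (hmul hX2.ofReal).div_const _
    rw [← integral_div, ← add_zero (∫ ω, Z ω * r ω ∂P), ← mul_zero Complex.I,
      ← integral_mul_eq_zero_of_condExp_eq_zero hm hZ hZ1 hX1 hX0, ← integral_const_mul,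
      ← integral_add hr' hX1', ← integral_sub (hr'.fun_add hX1') hX2']
    congr with ω
    simp only [r]
    ring
  have hrem : ‖∫ ω, Z ω * r ω ∂P‖ ≤ 4 * ∫ ω, |X ω| ^ 3 ∂P + v ^ 2 / 8 := by
    refine (norm_integral_mul_le_integral_of_norm_le hZ1 hr_bound hr_le).trans_eq ?_
    simp [integral_add (hX3.const_mul 4) (integrable_const _), integral_const_mul]
  rw [hsplit, add_comm (_ / 2)]
  refine (norm_sub_le _ _).trans (add_le_add hrem ?_)
  rw [norm_div, Complex.norm_ofNat]
  exact div_le_div_of_nonneg_right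
    (norm_integral_mul_le_integral_abs_condExp hm hZ hZ1 hX2) zero_le_two

/-- The sequence `X` is a sequence of martingale differences for the filtration `F`, with the index
convention that `X k` is the increment from time `k` to time `k + 1`. Integrability is not included:
where it is needed, higher moments are assumed. -/
structure IsMartingaleDifference (P : Measure Ω) (F : Filtration ℕ mΩ) (X : ℕ → Ω → ℝ) : Prop where
  stronglyMeasurable : ∀ k, StronglyMeasurable[F (k + 1)] (X k)
  condExp_eq_zero : ∀ k, P[X k | F k] =ᵐ[P] 0

namespace IsMartingaleDifference

variable {F : Filtration ℕ mΩ} {X : ℕ → Ω → ℝ}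

lemma const_mul (h : IsMartingaleDifference P F X) (t : ℝ) :
    IsMartingaleDifference P F fun k ω => t * X k ω where
  stronglyMeasurable k := (h.stronglyMeasurable k).const_mul t
  condExp_eq_zero k := by
    filter_upwards [condExp_smul (μ := P) t (X k) (F k), h.condExp_eq_zero k] with ω hsmul hzero
    exact hsmul.trans (by simp [hzero])

lemma stronglyMeasurable_sum (h : IsMartingaleDifference P F X) (n : ℕ) :
    StronglyMeasurable[F n] fun ω => ∑ k ∈ Finset.range n, X k ω :=
  Finset.stronglyMeasurable_fun_sum _ fun k hk =>
    (h.stronglyMeasurable k).mono (F.mono (Finset.mem_range.1 hk))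

lemma integral_sum_sq [IsFiniteMeasure P] (h : IsMartingaleDifference P F X)
    (hX : ∀ k, MemLp (X k) 2 P) (n : ℕ) :
    ∫ ω, (∑ k ∈ Finset.range n, X k ω) ^ 2 ∂P = ∑ k ∈ Finset.range n, ∫ ω, X k ω ^ 2 ∂P := by
  induction n with
  | zero => simp
  | succ n ih =>
    have hS : MemLp (fun ω => ∑ k ∈ Finset.range n, X k ω) 2 P :=
      memLp_finsetSum _ fun k _ => hX k
    have hSX : Integrable (fun ω => (∑ k ∈ Finset.range n, X k ω) * X n ω) P :=
      hS.integrable_mul (hX n)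
    have hzero : ∫ ω, (∑ k ∈ Finset.range n, X k ω) * X n ω ∂P = 0 := by
      rw [← integral_condExp (F.le n)]
      refine integral_eq_zero_of_ae ?_
      filter_upwards [condExp_mul_of_stronglyMeasurable_left (h.stronglyMeasurable_sum n) hSX
        ((hX n).integrable one_le_two), h.condExp_eq_zero n] with ω hpull hX0
      exact hpull.trans (by simp [hX0])
    simp only [Finset.sum_range_succ, add_sq, ← ih, mul_assoc]
    rw [integral_add (hS.integrable_sq.fun_add (hSX.const_mul 2)) (hX n).integrable_sq,
      integral_add hS.integrable_sq (hSX.const_mul 2), integral_const_mul, hzero, mul_zero,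
      add_zero]

lemma norm_integral_exp_sum_sub_le [IsProbabilityMeasure P] (h : IsMartingaleDifference P F X)
    (hX : ∀ k, MemLp (X k) 3 P) {v : ℕ → ℝ} (hv : ∀ k, 0 ≤ v k) (n : ℕ) :
    ‖∫ ω, Complex.exp ((∑ k ∈ Finset.range n, X k ω : ℝ) * Complex.I) ∂P -
        Real.exp (-((∑ k ∈ Finset.range n, v k) / 2))‖ ≤
      ∑ k ∈ Finset.range n, ((∫ ω, |P[fun ω => X k ω ^ 2 - v k | F k] ω| ∂P) / 2 +
        (4 * ∫ ω, |X k ω| ^ 3 ∂P + v k ^ 2 / 8)) := by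
  induction n with
  | zero => simp
  | succ n ih =>
    set Z : Ω → ℂ := fun ω => Complex.exp ((∑ k ∈ Finset.range n, X k ω : ℝ) * Complex.I)
    have hZ : StronglyMeasurable[F n] Z :=
      Complex.continuous_exp.comp_stronglyMeasurable
        ((Complex.continuous_ofReal.comp_stronglyMeasurable
          (h.stronglyMeasurable_sum n)).mul_const _)
    have hZ1 (ω : Ω) : ‖Z ω‖ ≤ 1 := (Complex.norm_exp_ofReal_mul_I _).le
    have hZi : Integrable Z P :=
      (integrable_const (1 : ℝ)).mono' (hZ.mono (F.le n)).aestronglyMeasurable (ae_of_all _ hZ1)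
    have hZX (ω : Ω) : Complex.exp ((∑ k ∈ Finset.range (n + 1), X k ω : ℝ) * Complex.I) =
        Z ω * Complex.exp (X n ω * Complex.I) := by
      simp only [Z, Finset.sum_range_succ, Complex.ofReal_add, add_mul, Complex.exp_add]
    have hZXi : Integrable (fun ω => Z ω * Complex.exp (X n ω * Complex.I)) P := by
      have := (hX n).1.aemeasurable
      refine hZi.mul_bdd (c := 1) (AEMeasurable.aestronglyMeasurable (by fun_prop))
        (ae_of_all _ fun ω => (Complex.norm_exp_ofReal_mul_I _).le)
    have hsplit : ∫ ω, Z ω * Complex.exp (X n ω * Complex.I) ∂P -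
          Real.exp (-((∑ k ∈ Finset.range (n + 1), v k) / 2)) =
        Real.exp (-(v n / 2)) * (∫ ω, Z ω ∂P - Real.exp (-((∑ k ∈ Finset.range n, v k) / 2))) +
          ∫ ω, Z ω * (Complex.exp (X n ω * Complex.I) - Real.exp (-(v n / 2))) ∂P := by
      simp only [mul_sub, Finset.sum_range_succ, add_div, neg_add, Real.exp_add]
      rw [integral_sub hZXi (hZi.mul_const _), integral_mul_const]
      push_cast
      ring
    simp only [hZX]
    rw [hsplit, Finset.sum_range_succ]
    refine (norm_add_le _ _).trans (add_le_add ?_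
      (norm_integral_mul_exp_sub_le (F.le n) hZ hZ1 (hX n) (h.condExp_eq_zero n) (hv n)))
    rw [norm_mul, Complex.norm_real, Real.norm_eq_abs, Real.abs_exp]
    exact (mul_le_of_le_one_left (norm_nonneg _)
      (Real.exp_le_one_iff.2 (by linarith [hv n]))).trans ih

lemma norm_integral_exp_mul_sum_sub_le [IsProbabilityMeasure P]
    (h : IsMartingaleDifference P F X) (hX : ∀ k, MemLp (X k) 4 P) (t : ℝ) (n : ℕ) :
    ‖∫ ω, Complex.exp ((t * ∑ k ∈ Finset.range n, X k ω : ℝ) * Complex.I) ∂P -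
        Real.exp (-(t ^ 2 * (∑ k ∈ Finset.range n, ∫ ω, X k ω ^ 2 ∂P) / 2))‖ ≤
      t ^ 2 / 2 * (∑ k ∈ Finset.range n,
          ∫ ω, |P[fun ω => X k ω ^ 2 - ∫ ω, X k ω ^ 2 ∂P | F k] ω| ∂P) +
        4 * |t| ^ 3 * (√(∑ k ∈ Finset.range n, ∫ ω, X k ω ^ 2 ∂P) *
          √(∑ k ∈ Finset.range n, ∫ ω, X k ω ^ 4 ∂P)) +
        t ^ 4 / 8 * ∑ k ∈ Finset.range n, ∫ ω, X k ω ^ 4 ∂P := by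
  have hstep := (h.const_mul t).norm_integral_exp_sum_sub_le
    (fun k => ((hX k).mono_exponent (by norm_num)).const_mul t)
    (v := fun k => t ^ 2 * ∫ ω, X k ω ^ 2 ∂P)
    (fun k => mul_nonneg (sq_nonneg t) (integral_nonneg fun ω => sq_nonneg _)) n
  have hcond (k : ℕ) :
      ∫ ω, |P[fun ω => t ^ 2 * X k ω ^ 2 - t ^ 2 * ∫ ω, X k ω ^ 2 ∂P | F k] ω| ∂P =
        t ^ 2 * ∫ ω, |P[fun ω => X k ω ^ 2 - ∫ ω, X k ω ^ 2 ∂P | F k] ω| ∂P := by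
    refine (integral_congr_ae ?_).trans (integral_const_mul _ _)
    filter_upwards [condExp_smul (μ := P) (t ^ 2)
      (fun ω => X k ω ^ 2 - ∫ ω, X k ω ^ 2 ∂P) (F k)] with ω hω
    simp only [← mul_sub]
    exact (congrArg abs hω).trans (by simp [abs_mul])
  have hthird : ∑ k ∈ Finset.range n, ∫ ω, |X k ω| ^ 3 ∂P ≤
      √(∑ k ∈ Finset.range n, ∫ ω, X k ω ^ 2 ∂P) *
        √(∑ k ∈ Finset.range n, ∫ ω, X k ω ^ 4 ∂P) :=
    (Finset.sum_le_sum fun k _ => integral_abs_pow_three_le (hX k)).trans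
      (Real.sum_sqrt_mul_sqrt_le _ (fun k => integral_nonneg fun ω => sq_nonneg (X k ω))
        fun k => integral_nonneg fun ω => (by positivity : 0 ≤ X k ω ^ 4))
  have hfourth : ∑ k ∈ Finset.range n, (∫ ω, X k ω ^ 2 ∂P) ^ 2 ≤
      ∑ k ∈ Finset.range n, ∫ ω, X k ω ^ 4 ∂P :=
    Finset.sum_le_sum fun k _ => sq_integral_sq_le (hX k)
  simp only [hcond, ← Finset.mul_sum, abs_mul, mul_pow, integral_const_mul, Finset.sum_add_distrib,
    ← Finset.sum_div, ← pow_mul, Nat.reduceMul] at hstep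
  refine hstep.trans ?_
  have := mul_le_mul_of_nonneg_left hthird (show 0 ≤ 4 * |t| ^ 3 by positivity)
  have := mul_le_mul_of_nonneg_left hfourth (show 0 ≤ t ^ 4 / 8 by positivity)
  linarith

end IsMartingaleDifference

theorem tendsto_integral_exp_mul_sum_of_isMartingaleDifference [IsProbabilityMeasure P]
    {ι : Type*} {l : Filter ι} {F : ι → Filtration ℕ mΩ} {X : ι → ℕ → Ω → ℝ} {n : ι → ℕ} {v : ℝ}
    (h : ∀ᶠ i in l, IsMartingaleDifference P (F i) (X i))
    (hX : ∀ᶠ i in l, ∀ k, MemLp (X i k) 4 P)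
    (hvar : Tendsto (fun i => ∑ k ∈ Finset.range (n i), ∫ ω, X i k ω ^ 2 ∂P) l (𝓝 v))
    (hcond : Tendsto (fun i => ∑ k ∈ Finset.range (n i),
      ∫ ω, |P[fun ω => X i k ω ^ 2 - ∫ ω, X i k ω ^ 2 ∂P | F i k] ω| ∂P) l (𝓝 0))
    (hfour : Tendsto (fun i => ∑ k ∈ Finset.range (n i), ∫ ω, X i k ω ^ 4 ∂P) l (𝓝 0)) (t : ℝ) :
    Tendsto (fun i => ∫ ω, Complex.exp
      ((t * ∑ k ∈ Finset.range (n i), X i k ω : ℝ) * Complex.I) ∂P) l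
      (𝓝 (Real.exp (-(t ^ 2 * v / 2)) : ℂ)) := by
  have hgauss : Tendsto (fun i => (Real.exp
      (-(t ^ 2 * (∑ k ∈ Finset.range (n i), ∫ ω, X i k ω ^ 2 ∂P) / 2)) : ℂ)) l
      (𝓝 (Real.exp (-(t ^ 2 * v / 2)) : ℂ)) :=
    (Complex.continuous_ofReal.comp (by fun_prop : Continuous fun x : ℝ =>
      Real.exp (-(t ^ 2 * x / 2)))).continuousAt.tendsto.comp hvar
  have herror := ((hcond.const_mul (t ^ 2 / 2)).add
    ((hvar.sqrt.mul hfour.sqrt).const_mul (4 * |t| ^ 3))).add (hfour.const_mul (t ^ 4 / 8))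
  simp only [Real.sqrt_zero, mul_zero, add_zero] at herror
  have hdiff := squeeze_zero_norm' (by
    filter_upwards [h, hX] with i hi hXi
    exact hi.norm_integral_exp_mul_sum_sub_le hXi t (n i)) herror
  simpa using hdiff.add hgauss

end MartingaleCLT

section WeightedWalk

variable {Ω G : Type*} [NormedAddCommGroup G] [InnerProductSpace ℝ G]

/-- The position after `n` steps of the walk whose `i`-th step is `ξ i • V i`. -/
def weightedWalk (ξ : ℕ → Ω → ℝ) (V : ℕ → Ω → G) (n : ℕ) (ω : Ω) : G :=
  ∑ i ∈ Finset.range n, ξ i ω • V i ω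

/-- The component of the walk at time `k` in the direction of its next step. For steps along the
coordinate axes it is the sum of the weights of those earlier steps which were made along the same
axis as step `k`. -/
def collisionSum (ξ : ℕ → Ω → ℝ) (V : ℕ → Ω → G) (k : ℕ) (ω : Ω) : ℝ :=
  inner ℝ (weightedWalk ξ V k ω) (V k ω)

lemma weightedWalk_succ (ξ : ℕ → Ω → ℝ) (V : ℕ → Ω → G) (n : ℕ) (ω : Ω) :
    weightedWalk ξ V (n + 1) ω = weightedWalk ξ V n ω + ξ n ω • V n ω :=
  Finset.sum_range_succ _ _

lemma norm_sq_weightedWalk (ξ : ℕ → Ω → ℝ) (V : ℕ → Ω → G) (n : ℕ) (ω : Ω) :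
    ‖weightedWalk ξ V n ω‖ ^ 2 = ∑ i ∈ Finset.range n, ξ i ω ^ 2 * ‖V i ω‖ ^ 2 +
      2 * ∑ i ∈ Finset.range n, ξ i ω * collisionSum ξ V i ω := by
  induction n with
  | zero => simp [weightedWalk]
  | succ n ih =>
    rw [weightedWalk_succ, norm_add_sq_real, ih, real_inner_smul_right, norm_smul, mul_pow,
      Real.norm_eq_abs, sq_abs, Finset.sum_range_succ, Finset.sum_range_succ, collisionSum]
    ring

lemma collisionSum_sub (ξ η : ℕ → Ω → ℝ) (V : ℕ → Ω → G) (k : ℕ) (ω : Ω) :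
    collisionSum (fun i ω => ξ i ω - η i ω) V k ω =
      collisionSum ξ V k ω - collisionSum η V k ω := by
  simp only [collisionSum, weightedWalk, sub_smul, Finset.sum_sub_distrib, inner_sub_left]

end WeightedWalk

/-- The driving noise of a walk along the coordinate axes of `ℝ^d`: the mark `R k` has law `μ`, the
direction `V k` is uniform on the standard basis, the two are independent of each other, and the
pair is independent of the past `F k`. -/
structure IsAxisNoise {Ω E : Type*} [mΩ : MeasurableSpace Ω] [MeasurableSpace E] (P : Measure Ω)
    (F : Filtration ℕ mΩ) (μ : Measure E) {d : ℕ} (R : ℕ → Ω → E)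
    (V : ℕ → Ω → EuclideanSpace ℝ (Fin d)) : Prop where
  measurable_R : ∀ k, Measurable[F (k + 1)] (R k)
  measurable_V : ∀ k, Measurable[F (k + 1)] (V k)
  map_R : ∀ k, P.map (R k) = μ
  ae_eq_single : ∀ k, ∀ᵐ ω ∂P, ∃ j, V k ω = EuclideanSpace.single j (1 : ℝ)
  uniform_V : ∀ k j, P.real {ω | V k ω = EuclideanSpace.single j (1 : ℝ)} = (d : ℝ)⁻¹
  indep_R_V : ∀ k, IndepFun (R k) (V k) P
  indep_past : ∀ k,
    Indep (MeasurableSpace.comap (fun ω => (R k ω, V k ω)) inferInstance) (F k) P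

namespace IsAxisNoise

variable {Ω E : Type*} [mΩ : MeasurableSpace Ω] [MeasurableSpace E] {P : Measure Ω}
  {F : Filtration ℕ mΩ} {μ : Measure E} {d : ℕ} {R : ℕ → Ω → E}
  {V : ℕ → Ω → EuclideanSpace ℝ (Fin d)}

lemma aemeasurable_R (h : IsAxisNoise P F μ R V) (k : ℕ) : AEMeasurable (R k) P :=
  ((h.measurable_R k).mono (F.le _) le_rfl).aemeasurable

lemma isProbabilityMeasure [IsProbabilityMeasure P] (h : IsAxisNoise P F μ R V) :
    IsProbabilityMeasure μ := by
  rw [← h.map_R 0]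
  exact Measure.isProbabilityMeasure_map (h.aemeasurable_R 0)

lemma integral_comp (h : IsAxisNoise P F μ R V) {u : E → ℝ} (hu : AEStronglyMeasurable u μ)
    (k : ℕ) : ∫ ω, u (R k ω) ∂P = ∫ x, u x ∂μ := by
  rw [← h.map_R k, integral_map (h.aemeasurable_R k) (by rwa [h.map_R k])]

lemma memLp_comp (h : IsAxisNoise P F μ R V) {u : E → ℝ} {p : ENNReal} (hu : MemLp u p μ)
    (k : ℕ) : MemLp (fun ω => u (R k ω)) p P :=
  MemLp.comp_of_map (by rwa [h.map_R k]) (h.aemeasurable_R k)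

lemma integrable_comp (h : IsAxisNoise P F μ R V) {u : E → ℝ} (hu : Integrable u μ)
    (k : ℕ) : Integrable (fun ω => u (R k ω)) P :=
  memLp_one_iff_integrable.1 (h.memLp_comp (memLp_one_iff_integrable.2 hu) k)

lemma measurable_V_apply (h : IsAxisNoise P F μ R V) (k : ℕ) (j : Fin d) :
    Measurable[F (k + 1)] fun ω => V k ω j :=
  (by fun_prop : Measurable fun v : EuclideanSpace ℝ (Fin d) => v j).comp (h.measurable_V k)

lemma ae_abs_V_apply_le_one (h : IsAxisNoise P F μ R V) (k : ℕ) (j : Fin d) :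
    ∀ᵐ ω ∂P, |V k ω j| ≤ 1 := by
  filter_upwards [h.ae_eq_single k] with ω ⟨i, hi⟩
  rw [hi, PiLp.single_apply]
  split_ifs <;> simp

lemma ae_norm_V_eq_one (h : IsAxisNoise P F μ R V) : ∀ᵐ ω ∂P, ∀ k, ‖V k ω‖ = 1 := by
  refine ae_all_iff.2 fun k => ?_
  filter_upwards [h.ae_eq_single k] with ω ⟨i, hi⟩
  simp [hi]

lemma integral_V_apply (h : IsAxisNoise P F μ R V) (k : ℕ) (j : Fin d) :
    ∫ ω, V k ω j ∂P = (d : ℝ)⁻¹ := by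
  have hmeas : MeasurableSet {ω | V k ω = EuclideanSpace.single j (1 : ℝ)} :=
    ((h.measurable_V k).mono (F.le _) le_rfl) (measurableSet_singleton _)
  rw [← h.uniform_V k j, ← integral_indicator_one hmeas]
  refine integral_congr_ae ?_
  filter_upwards [h.ae_eq_single k] with ω ⟨i, hi⟩
  have hsingle : (EuclideanSpace.single i (1 : ℝ) = EuclideanSpace.single j 1) ↔ j = i :=
    ⟨fun he => by simpa using congrArg (fun v => v j) he.symm, fun he => by rw [he]⟩
  simp [hi, Set.indicator, hsingle]

lemma memLp_mul_V_apply (h : IsAxisNoise P F μ R V) {k : ℕ} {Y : Ω → ℝ} {p : ENNReal}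
    (hY : MemLp Y p P) (j : Fin d) : MemLp (fun ω => Y ω * V k ω j) p P := by
  refine hY.of_le (hY.1.mul
    ((h.measurable_V_apply k j).mono (F.le _) le_rfl).aestronglyMeasurable) ?_
  filter_upwards [h.ae_abs_V_apply_le_one k j] with ω hω
  rw [norm_mul]
  exact mul_le_of_le_one_right (norm_nonneg _) hω

lemma integral_comp_mul_V_apply (h : IsAxisNoise P F μ R V) {u : E → ℝ} (hu : Measurable u)
    (k : ℕ) (j : Fin d) : ∫ ω, u (R k ω) * V k ω j ∂P = (∫ x, u x ∂μ) * (d : ℝ)⁻¹ := by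
  have hindep : IndepFun (fun ω => u (R k ω)) (fun ω => V k ω j) P :=
    (h.indep_R_V k).comp hu (by fun_prop : Measurable fun v : EuclideanSpace ℝ (Fin d) => v j)
  rw [← h.integral_comp hu.aestronglyMeasurable k, ← h.integral_V_apply k j]
  exact hindep.integral_fun_mul_eq_mul_integral
    (hu.comp_aemeasurable (h.aemeasurable_R k)).aestronglyMeasurable
    ((h.measurable_V_apply k j).mono (F.le _) le_rfl).aestronglyMeasurable

lemma condExp_comp_mul_V_apply [IsProbabilityMeasure P] (h : IsAxisNoise P F μ R V) {u : E → ℝ}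
    (hu : Measurable u) (k : ℕ) (j : Fin d) :
    P[fun ω => u (R k ω) * V k ω j | F k] =ᵐ[P] fun _ => (∫ x, u x ∂μ) * (d : ℝ)⁻¹ := by
  have hle : MeasurableSpace.comap (fun ω => (R k ω, V k ω)) inferInstance ≤ mΩ :=
    (((h.measurable_R k).prodMk (h.measurable_V k)).mono (F.le _) le_rfl).comap_le
  have hmeas : Measurable fun p : E × EuclideanSpace ℝ (Fin d) => u p.1 * p.2 j := by fun_prop
  rw [← h.integral_comp_mul_V_apply hu k j]
  exact condExp_indep_eq hle (F.le k)
    (hmeas.comp (comap_measurable fun ω => (R k ω, V k ω))).stronglyMeasurable (h.indep_past k)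

lemma condExp_comp [IsProbabilityMeasure P] (h : IsAxisNoise P F μ R V) {u : E → ℝ}
    (hu : Measurable u) (k : ℕ) :
    P[fun ω => u (R k ω) | F k] =ᵐ[P] fun _ => ∫ x, u x ∂μ := by
  have hle : MeasurableSpace.comap (fun ω => (R k ω, V k ω)) inferInstance ≤ mΩ :=
    (((h.measurable_R k).prodMk (h.measurable_V k)).mono (F.le _) le_rfl).comap_le
  rw [← h.integral_comp hu.aestronglyMeasurable k]
  exact condExp_indep_eq hle (F.le k) ((hu.comp measurable_fst).comp
    (comap_measurable fun ω => (R k ω, V k ω))).stronglyMeasurable (h.indep_past k)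

lemma indepFun_comp_mul_V_apply (h : IsAxisNoise P F μ R V) {u : E → ℝ} (hu : Measurable u)
    {k : ℕ} {Y : Ω → ℝ} (hY : Measurable[F k] Y) (j : Fin d) :
    IndepFun (fun ω => u (R k ω) * V k ω j) Y P := by
  have hmeas : Measurable fun p : E × EuclideanSpace ℝ (Fin d) => u p.1 * p.2 j := by fun_prop
  exact indep_of_indep_of_le_left (indep_of_indep_of_le_right (h.indep_past k) hY.comap_le)
    (hmeas.comp (comap_measurable fun ω => (R k ω, V k ω))).comap_le

section Evaluation

variable {u : E → ℝ} {k : ℕ} {H : Fin d → Ω → ℝ}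

lemma integrable_comp_mul_V_apply_mul (h : IsAxisNoise P F μ R V) (hu : Measurable u)
    (hui : Integrable u μ) (hH : ∀ j, Measurable[F k] (H j)) (hHi : ∀ j, Integrable (H j) P)
    (j : Fin d) : Integrable (fun ω => u (R k ω) * V k ω j * H j ω) P :=
  (h.indepFun_comp_mul_V_apply hu (hH j) j).integrable_mul (memLp_one_iff_integrable.1
    (h.memLp_mul_V_apply (memLp_one_iff_integrable.2 (h.integrable_comp hui k)) j)) (hHi j)

lemma integrable_comp_mul_sum_V_mul (h : IsAxisNoise P F μ R V) (hu : Measurable u)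
    (hui : Integrable u μ) (hH : ∀ j, Measurable[F k] (H j)) (hHi : ∀ j, Integrable (H j) P) :
    Integrable (fun ω => u (R k ω) * ∑ j, V k ω j * H j ω) P := by
  simp only [Finset.mul_sum, ← mul_assoc]
  exact integrable_finsetSum _ fun j _ => h.integrable_comp_mul_V_apply_mul hu hui hH hHi j

lemma condExp_comp_mul_sum_V_mul [IsProbabilityMeasure P] (h : IsAxisNoise P F μ R V)
    (hu : Measurable u) (hui : Integrable u μ) (hH : ∀ j, Measurable[F k] (H j))
    (hHi : ∀ j, Integrable (H j) P) :
    P[fun ω => u (R k ω) * ∑ j, V k ω j * H j ω | F k] =ᵐ[P]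
      fun ω => (∫ x, u x ∂μ) * ((d : ℝ)⁻¹ * ∑ j, H j ω) := by
  have hint := h.integrable_comp_mul_V_apply_mul hu hui hH hHi
  have hpull (j : Fin d) : P[fun ω => u (R k ω) * V k ω j * H j ω | F k] =ᵐ[P]
      fun ω => (∫ x, u x ∂μ) * (d : ℝ)⁻¹ * H j ω := by
    filter_upwards [condExp_mul_of_stronglyMeasurable_right (hH j).stronglyMeasurable (hint j)
      (memLp_one_iff_integrable.1 (h.memLp_mul_V_apply
        (memLp_one_iff_integrable.2 (h.integrable_comp hui k)) j)),
      h.condExp_comp_mul_V_apply hu k j] with ω hω huω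
    exact hω.trans (congrArg (· * H j ω) huω)
  have hsum : (fun ω => u (R k ω) * ∑ j, V k ω j * H j ω) =
      ∑ j, fun ω => u (R k ω) * V k ω j * H j ω := by
    ext ω
    simp [Finset.mul_sum, mul_assoc]
  rw [hsum]
  filter_upwards [condExp_finsetSum (s := Finset.univ) (fun j _ => hint j) (F k),
    ae_all_iff.2 hpull] with ω hω hjω
  rw [hω, Finset.sum_apply, Finset.mul_sum, Finset.mul_sum]
  exact Finset.sum_congr rfl fun j _ => (hjω j).trans (mul_assoc _ _ _)

lemma integral_comp_mul_sum_V_mul [IsProbabilityMeasure P] (h : IsAxisNoise P F μ R V)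
    (hu : Measurable u) (hui : Integrable u μ) (hH : ∀ j, Measurable[F k] (H j))
    (hHi : ∀ j, Integrable (H j) P) :
    ∫ ω, u (R k ω) * ∑ j, V k ω j * H j ω ∂P =
      (∫ x, u x ∂μ) * ((d : ℝ)⁻¹ * ∑ j, ∫ ω, H j ω ∂P) := by
  rw [← integral_condExp (F.le k), integral_congr_ae (h.condExp_comp_mul_sum_V_mul hu hui hH hHi),
    integral_const_mul, integral_const_mul, integral_finsetSum _ fun j _ => hHi j]

end Evaluation

end IsAxisNoise

lemma sum_range_cast (n : ℕ) : ∑ k ∈ Finset.range n, (k : ℝ) = ((n : ℝ) ^ 2 - n) / 2 := by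
  induction n with
  | zero => simp
  | succ n ih =>
    rw [Finset.sum_range_succ, ih]
    push_cast
    ring

section Coordinates

variable {Ω : Type*} {d : ℕ}

lemma weightedWalk_apply (ξ : ℕ → Ω → ℝ) (V : ℕ → Ω → EuclideanSpace ℝ (Fin d)) (k : ℕ) (ω : Ω)
    (j : Fin d) : weightedWalk ξ V k ω j = ∑ i ∈ Finset.range k, ξ i ω * V i ω j := by
  simp [weightedWalk]

lemma collisionSum_eq_sum (ξ : ℕ → Ω → ℝ) (V : ℕ → Ω → EuclideanSpace ℝ (Fin d)) (k : ℕ) (ω : Ω) :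
    collisionSum ξ V k ω = ∑ j, V k ω j * weightedWalk ξ V k ω j := by
  simp [collisionSum, PiLp.inner_apply]

end Coordinates

namespace IsAxisNoise

variable {Ω E : Type*} [mΩ : MeasurableSpace Ω] [MeasurableSpace E] {P : Measure Ω}
  {F : Filtration ℕ mΩ} {μ : Measure E} {d : ℕ} {R : ℕ → Ω → E}
  {V : ℕ → Ω → EuclideanSpace ℝ (Fin d)} {u f : E → ℝ}

lemma ae_apply_collisionSum (h : IsAxisNoise P F μ R V) (φ : ℝ → ℝ) (ξ : ℕ → Ω → ℝ) (k : ℕ) :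
    ∀ᵐ ω ∂P, φ (collisionSum ξ V k ω) = ∑ j, V k ω j * φ (weightedWalk ξ V k ω j) := by
  filter_upwards [h.ae_eq_single k] with ω ⟨i, hi⟩
  simp [collisionSum_eq_sum, hi]

lemma ae_sum_weightedWalk_apply (h : IsAxisNoise P F μ R V) (ξ : ℕ → Ω → ℝ) (k : ℕ) :
    ∀ᵐ ω ∂P, ∑ j, weightedWalk ξ V k ω j = ∑ i ∈ Finset.range k, ξ i ω := by
  filter_upwards [ae_all_iff.2 h.ae_eq_single] with ω hω
  simp only [weightedWalk_apply]
  rw [Finset.sum_comm]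
  refine Finset.sum_congr rfl fun i _ => ?_
  obtain ⟨j, hj⟩ := hω i
  simp [hj]

lemma ae_norm_sq_weightedWalk (h : IsAxisNoise P F μ R V) (ξ : ℕ → Ω → ℝ) (n : ℕ) :
    ∀ᵐ ω ∂P, ‖weightedWalk ξ V n ω‖ ^ 2 = ∑ i ∈ Finset.range n, ξ i ω ^ 2 +
      2 * ∑ i ∈ Finset.range n, ξ i ω * collisionSum ξ V i ω := by
  filter_upwards [h.ae_norm_V_eq_one] with ω hω
  simp [norm_sq_weightedWalk, hω]

lemma measurable_weightedWalk_apply (h : IsAxisNoise P F μ R V) (hf : Measurable f) (k : ℕ)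
    (j : Fin d) : Measurable[F k] fun ω => weightedWalk (fun i ω => f (R i ω)) V k ω j := by
  simp only [weightedWalk_apply]
  refine Finset.measurable_fun_sum _ fun i hi => ?_
  have hle := F.mono (Finset.mem_range.1 hi)
  exact ((hf.comp (h.measurable_R i)).mono hle le_rfl).mul
    ((h.measurable_V_apply i j).mono hle le_rfl)

lemma memLp_weightedWalk_apply (h : IsAxisNoise P F μ R V) {p : ENNReal} (hf : MemLp f p μ)
    (k : ℕ) (j : Fin d) : MemLp (fun ω => weightedWalk (fun i ω => f (R i ω)) V k ω j) p P := by
  simp only [weightedWalk_apply]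
  exact memLp_finsetSum _ fun i _ => h.memLp_mul_V_apply (h.memLp_comp hf i) j

lemma measurable_collisionSum (h : IsAxisNoise P F μ R V) (hf : Measurable f) (k : ℕ) :
    Measurable[F (k + 1)] (collisionSum (fun i ω => f (R i ω)) V k) := by
  have hC : collisionSum (fun i ω => f (R i ω)) V k =
      fun ω => ∑ j, V k ω j * weightedWalk (fun i ω => f (R i ω)) V k ω j :=
    funext fun ω => collisionSum_eq_sum _ _ _ _
  rw [hC]
  exact Finset.measurable_fun_sum _ fun j _ => (h.measurable_V_apply k j).mul
    ((h.measurable_weightedWalk_apply hf k j).mono (F.mono k.le_succ) le_rfl)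

section Evaluation

variable {φ : ℝ → ℝ} {k : ℕ}

lemma integrable_comp_mul_apply_collisionSum (h : IsAxisNoise P F μ R V) (hu : Measurable u)
    (hui : Integrable u μ) (hf : Measurable f) (hφ : Measurable φ)
    (hφi : ∀ j, Integrable (fun ω => φ (weightedWalk (fun i ω => f (R i ω)) V k ω j)) P) :
    Integrable (fun ω => u (R k ω) * φ (collisionSum (fun i ω => f (R i ω)) V k ω)) P :=
  (h.integrable_comp_mul_sum_V_mul hu hui
    (fun j => hφ.comp (h.measurable_weightedWalk_apply hf k j)) hφi).congr
    ((h.ae_apply_collisionSum φ _ k).mono fun ω hω => congrArg (u (R k ω) * ·) hω.symm)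

lemma condExp_comp_mul_apply_collisionSum [IsProbabilityMeasure P] (h : IsAxisNoise P F μ R V)
    (hu : Measurable u) (hui : Integrable u μ) (hf : Measurable f) (hφ : Measurable φ)
    (hφi : ∀ j, Integrable (fun ω => φ (weightedWalk (fun i ω => f (R i ω)) V k ω j)) P) :
    P[fun ω => u (R k ω) * φ (collisionSum (fun i ω => f (R i ω)) V k ω) | F k] =ᵐ[P]
      fun ω => (∫ x, u x ∂μ) *
        ((d : ℝ)⁻¹ * ∑ j, φ (weightedWalk (fun i ω => f (R i ω)) V k ω j)) :=
  (condExp_congr_ae ((h.ae_apply_collisionSum φ _ k).mono fun ω hω =>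
    congrArg (u (R k ω) * ·) hω)).trans (h.condExp_comp_mul_sum_V_mul hu hui
      (fun j => hφ.comp (h.measurable_weightedWalk_apply hf k j)) hφi)

lemma integral_comp_mul_apply_collisionSum [IsProbabilityMeasure P] (h : IsAxisNoise P F μ R V)
    (hu : Measurable u) (hui : Integrable u μ) (hf : Measurable f) (hφ : Measurable φ)
    (hφi : ∀ j, Integrable (fun ω => φ (weightedWalk (fun i ω => f (R i ω)) V k ω j)) P) :
    ∫ ω, u (R k ω) * φ (collisionSum (fun i ω => f (R i ω)) V k ω) ∂P =
      (∫ x, u x ∂μ) *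
        ((d : ℝ)⁻¹ * ∑ j, ∫ ω, φ (weightedWalk (fun i ω => f (R i ω)) V k ω j) ∂P) :=
  (integral_congr_ae ((h.ae_apply_collisionSum φ _ k).mono fun ω hω =>
    congrArg (u (R k ω) * ·) hω)).trans (h.integral_comp_mul_sum_V_mul hu hui
      (fun j => hφ.comp (h.measurable_weightedWalk_apply hf k j)) hφi)

end Evaluation

lemma memLp_comp_mul_collisionSum (h : IsAxisNoise P F μ R V) {p : ℕ} (hp : p ≠ 0)
    (hu : Measurable u) (hup : MemLp u p μ) (hf : Measurable f) (hfp : MemLp f p μ) (k : ℕ) :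
    MemLp (fun ω => u (R k ω) * collisionSum (fun i ω => f (R i ω)) V k ω) p P := by
  have hmeas : AEStronglyMeasurable
      (fun ω => u (R k ω) * collisionSum (fun i ω => f (R i ω)) V k ω) P :=
    (((hu.comp (h.measurable_R k)).mul (h.measurable_collisionSum hf k)).mono
      (F.le _) le_rfl).aestronglyMeasurable
  rw [← integrable_abs_pow_iff_memLp hmeas hp]
  simp only [abs_mul, mul_pow]
  exact h.integrable_comp_mul_apply_collisionSum (u := fun x => |u x| ^ p) (φ := fun x => |x| ^ p)
    (by fun_prop) ((integrable_abs_pow_iff_memLp hup.1 hp).2 hup) hf (by fun_prop) fun j =>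
      (integrable_abs_pow_iff_memLp (h.memLp_weightedWalk_apply hfp k j).1 hp).2
        (h.memLp_weightedWalk_apply hfp k j)

lemma isMartingaleDifference_comp [IsProbabilityMeasure P] (h : IsAxisNoise P F μ R V)
    (hu : Measurable u) (hu0 : ∫ x, u x ∂μ = 0) :
    IsMartingaleDifference P F fun k ω => u (R k ω) where
  stronglyMeasurable k := (hu.comp (h.measurable_R k)).stronglyMeasurable
  condExp_eq_zero k := (h.condExp_comp hu k).trans (by rw [hu0]; rfl)

lemma isMartingaleDifference_comp_mul_collisionSum [IsProbabilityMeasure P]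
    (h : IsAxisNoise P F μ R V) (hu : Measurable u) (hui : Integrable u μ)
    (hu0 : ∫ x, u x ∂μ = 0) (hf : Measurable f) (hfi : Integrable f μ) :
    IsMartingaleDifference P F
      fun k ω => u (R k ω) * collisionSum (fun i ω => f (R i ω)) V k ω where
  stronglyMeasurable k :=
    ((hu.comp (h.measurable_R k)).mul (h.measurable_collisionSum hf k)).stronglyMeasurable
  condExp_eq_zero k := by
    refine (h.condExp_comp_mul_apply_collisionSum hu hui hf measurable_id fun j =>
      memLp_one_iff_integrable.1
        (h.memLp_weightedWalk_apply (memLp_one_iff_integrable.2 hfi) k j)).trans ?_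
    rw [hu0]
    exact ae_of_all _ fun ω => zero_mul _

lemma integral_sum_comp_sq [IsProbabilityMeasure P] (h : IsAxisNoise P F μ R V)
    (hu : Measurable u) (hu2 : MemLp u 2 μ) (hu0 : ∫ x, u x ∂μ = 0) (n : ℕ) :
    ∫ ω, (∑ k ∈ Finset.range n, u (R k ω)) ^ 2 ∂P = n * ∫ x, u x ^ 2 ∂μ := by
  rw [(h.isMartingaleDifference_comp hu hu0).integral_sum_sq (h.memLp_comp hu2) n]
  simp [fun k => h.integral_comp (u := fun x => u x ^ 2) (by fun_prop) k]

section SecondMoment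

variable [IsProbabilityMeasure P]

lemma integral_norm_sq_weightedWalk (h : IsAxisNoise P F μ R V) (hf : Measurable f)
    (hf2 : MemLp f 2 μ) (hf0 : ∫ x, f x ∂μ = 0) (n : ℕ) :
    ∫ ω, ‖weightedWalk (fun i ω => f (R i ω)) V n ω‖ ^ 2 ∂P = n * ∫ x, f x ^ 2 ∂μ := by
  have := h.isProbabilityMeasure
  have hf1 : Integrable f μ := hf2.integrable one_le_two
  have hW (i : ℕ) (j : Fin d) :
      Integrable (fun ω => weightedWalk (fun i ω => f (R i ω)) V i ω j) P :=
    (h.memLp_weightedWalk_apply hf2 i j).integrable one_le_two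
  have hsq (i : ℕ) : Integrable (fun ω => f (R i ω) ^ 2) P := (h.memLp_comp hf2 i).integrable_sq
  have hcross (i : ℕ) :
      Integrable (fun ω => f (R i ω) * collisionSum (fun i ω => f (R i ω)) V i ω) P :=
    h.integrable_comp_mul_apply_collisionSum hf hf1 hf measurable_id (hW i)
  have hcross0 (i : ℕ) : ∫ ω, f (R i ω) * collisionSum (fun i ω => f (R i ω)) V i ω ∂P = 0 := by
    simpa [hf0] using h.integral_comp_mul_apply_collisionSum hf hf1 hf measurable_id (hW i)
  rw [integral_congr_ae (h.ae_norm_sq_weightedWalk _ n),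
    integral_add (integrable_finsetSum _ fun i _ => hsq i)
      ((integrable_finsetSum _ fun i _ => hcross i).const_mul 2),
    integral_const_mul, integral_finsetSum _ fun i _ => hsq i,
    integral_finsetSum _ fun i _ => hcross i]
  simp [hcross0, fun k => h.integral_comp (u := fun x => f x ^ 2) (by fun_prop) k]

lemma integral_comp_mul_collisionSum_sq (h : IsAxisNoise P F μ R V) (hu : Measurable u)
    (hui : Integrable u μ) (hf : Measurable f) (hf2 : MemLp f 2 μ)
    (hf0 : ∫ x, f x ∂μ = 0) (k : ℕ) :
    ∫ ω, u (R k ω) * collisionSum (fun i ω => f (R i ω)) V k ω ^ 2 ∂P =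
      (∫ x, u x ∂μ) * ((∫ x, f x ^ 2 ∂μ) * (k / d)) := by
  have hW (j : Fin d) :
      Integrable (fun ω => weightedWalk (fun i ω => f (R i ω)) V k ω j ^ 2) P :=
    (h.memLp_weightedWalk_apply hf2 k j).integrable_sq
  rw [h.integral_comp_mul_apply_collisionSum (φ := fun x => x ^ 2) hu hui hf (by fun_prop) hW,
    ← integral_finsetSum _ fun j _ => hW j]
  simp only [← EuclideanSpace.real_norm_sq_eq, h.integral_norm_sq_weightedWalk hf hf2 hf0 k]
  ring

lemma integral_sum_comp_mul_collisionSum_sq_le (h : IsAxisNoise P F μ R V) (hu : Measurable u)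
    (hu2 : MemLp u 2 μ) (hu0 : ∫ x, u x ∂μ = 0) (hf : Measurable f) (hf2 : MemLp f 2 μ)
    (hf0 : ∫ x, f x ∂μ = 0) (n : ℕ) :
    ∫ ω, (∑ k ∈ Finset.range n,
        u (R k ω) * collisionSum (fun i ω => f (R i ω)) V k ω) ^ 2 ∂P ≤
      (∫ x, u x ^ 2 ∂μ) * (∫ x, f x ^ 2 ∂μ) * ((n : ℝ) ^ 2 / (2 * d)) := by
  have := h.isProbabilityMeasure
  have hmart := h.isMartingaleDifference_comp_mul_collisionSum hu (hu2.integrable one_le_two) hu0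
    hf (hf2.integrable one_le_two)
  have hL2 (k : ℕ) := h.memLp_comp_mul_collisionSum two_ne_zero hu hu2 hf hf2 k
  have hmoment (k : ℕ) := h.integral_comp_mul_collisionSum_sq (u := fun x => u x ^ 2)
    (by fun_prop) hu2.integrable_sq hf hf2 hf0 k
  rw [hmart.integral_sum_sq hL2]
  simp only [mul_pow, hmoment, ← Finset.mul_sum, ← Finset.sum_div]
  rw [mul_assoc, ← div_div]
  have : 0 ≤ ∫ x, u x ^ 2 ∂μ := integral_nonneg fun x => sq_nonneg (u x)
  have : 0 ≤ ∫ x, f x ^ 2 ∂μ := integral_nonneg fun x => sq_nonneg (f x)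
  gcongr
  linarith [sum_range_cast n, n.cast_nonneg (α := ℝ)]

end SecondMoment

end IsAxisNoise

section FourthMoment

variable {Ω : Type*} [MeasurableSpace Ω] {P : Measure Ω} {X Y : Ω → ℝ}

lemma integrable_pow_of_memLp_four [IsFiniteMeasure P] (hX : MemLp X 4 P) {m : ℕ} (hm : m ≤ 4) :
    Integrable (fun ω => X ω ^ m) P := by
  rcases eq_or_ne m 0 with rfl | hm0
  · simp
  · refine ((integrable_abs_pow_iff_memLp hX.1 hm0).2
      (hX.mono_exponent (by exact_mod_cast hm))).mono (hX.1.pow m) (ae_of_all _ fun ω => ?_)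
    simp

lemma integral_pow_four_add_of_indepFun [IsProbabilityMeasure P] (hXY : IndepFun X Y P)
    (hX : MemLp X 4 P) (hY : MemLp Y 4 P) (hX0 : ∫ ω, X ω ∂P = 0) (hY0 : ∫ ω, Y ω ∂P = 0) :
    ∫ ω, (X ω + Y ω) ^ 4 ∂P = ∫ ω, X ω ^ 4 ∂P +
      6 * ((∫ ω, X ω ^ 2 ∂P) * ∫ ω, Y ω ^ 2 ∂P) + ∫ ω, Y ω ^ 4 ∂P := by
  have hindep (p q : ℕ) : IndepFun (fun ω => X ω ^ p) (fun ω => Y ω ^ q) P :=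
    hXY.comp (measurable_id.pow_const p) (measurable_id.pow_const q)
  have hint (m : ℕ) (hm : m ∈ Finset.range (4 + 1)) :
      Integrable (fun ω => X ω ^ m * Y ω ^ (4 - m) * Nat.choose 4 m) P :=
    ((hindep m (4 - m)).integrable_mul
      (integrable_pow_of_memLp_four hX (Finset.mem_range_succ_iff.1 hm))
      (integrable_pow_of_memLp_four hY (Nat.sub_le 4 m))).mul_const _
  have hmul (p q : ℕ) : ∫ ω, X ω ^ p * Y ω ^ q ∂P = (∫ ω, X ω ^ p ∂P) * ∫ ω, Y ω ^ q ∂P :=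
    (hindep p q).integral_fun_mul_eq_mul_integral (hX.1.pow p) (hY.1.pow q)
  simp only [add_pow]
  rw [integral_finsetSum _ hint]
  simp only [integral_mul_const, hmul, Finset.sum_range_succ, Finset.sum_range_zero]
  have hchoose : Nat.choose 4 2 = 6 := rfl
  simp [hX0, hY0, hchoose]
  ring

end FourthMoment

namespace IsAxisNoise

variable {Ω E : Type*} [mΩ : MeasurableSpace Ω] [MeasurableSpace E] {P : Measure Ω}
  {F : Filtration ℕ mΩ} {μ : Measure E} {d : ℕ} {R : ℕ → Ω → E}
  {V : ℕ → Ω → EuclideanSpace ℝ (Fin d)} {u f : E → ℝ}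

lemma integral_comp_mul_V_apply_pow (h : IsAxisNoise P F μ R V) (hu : Measurable u) {p : ℕ}
    (hp : p ≠ 0) (k : ℕ) (j : Fin d) :
    ∫ ω, (u (R k ω) * V k ω j) ^ p ∂P = (∫ x, u x ^ p ∂μ) * (d : ℝ)⁻¹ := by
  rw [← h.integral_comp_mul_V_apply (u := fun x => u x ^ p) (by fun_prop) k j]
  refine integral_congr_ae ?_
  filter_upwards [h.ae_eq_single k] with ω ⟨i, hi⟩
  rw [hi, PiLp.single_apply]
  split_ifs <;> simp [hp]

lemma ae_norm_sq_weightedWalk_sub (h : IsAxisNoise P F μ R V) (ξ : ℕ → Ω → ℝ) (c : ℝ) (n : ℕ) :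
    ∀ᵐ ω ∂P, ‖weightedWalk ξ V n ω‖ ^ 2 - n * c = ∑ i ∈ Finset.range n, (ξ i ω ^ 2 - c) +
      2 * ∑ i ∈ Finset.range n, ξ i ω * collisionSum ξ V i ω := by
  filter_upwards [h.ae_norm_sq_weightedWalk ξ n] with ω hω
  rw [hω, Finset.sum_sub_distrib, Finset.sum_const, Finset.card_range, nsmul_eq_mul]
  ring

variable [IsProbabilityMeasure P]

lemma isMartingaleDifference_comp_mul_V_apply (h : IsAxisNoise P F μ R V) (hf : Measurable f)
    (hf0 : ∫ x, f x ∂μ = 0) (j : Fin d) :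
    IsMartingaleDifference P F fun k ω => f (R k ω) * V k ω j where
  stronglyMeasurable k :=
    ((hf.comp (h.measurable_R k)).mul (h.measurable_V_apply k j)).stronglyMeasurable
  condExp_eq_zero k := (h.condExp_comp_mul_V_apply hf k j).trans (by simp [hf0]; rfl)

lemma integral_weightedWalk_apply_sq (h : IsAxisNoise P F μ R V) (hf : Measurable f)
    (hf2 : MemLp f 2 μ) (hf0 : ∫ x, f x ∂μ = 0) (k : ℕ) (j : Fin d) :
    ∫ ω, weightedWalk (fun i ω => f (R i ω)) V k ω j ^ 2 ∂P = (∫ x, f x ^ 2 ∂μ) * (k / d) := by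
  simp only [weightedWalk_apply]
  rw [(h.isMartingaleDifference_comp_mul_V_apply hf hf0 j).integral_sum_sq
    (fun i => h.memLp_mul_V_apply (h.memLp_comp hf2 i) j) k]
  simp only [h.integral_comp_mul_V_apply_pow hf two_ne_zero, Finset.sum_const, Finset.card_range,
    nsmul_eq_mul]
  ring

lemma integral_weightedWalk_apply_pow_four_le (h : IsAxisNoise P F μ R V) (hf : Measurable f)
    (hf4 : MemLp f 4 μ) (hf0 : ∫ x, f x ∂μ = 0) (k : ℕ) (j : Fin d) :
    ∫ ω, weightedWalk (fun i ω => f (R i ω)) V k ω j ^ 4 ∂P ≤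
      (∫ x, f x ^ 4 ∂μ) * (k / d) + 3 * ((∫ x, f x ^ 2 ∂μ) * (k / d)) ^ 2 := by
  have := h.isProbabilityMeasure
  have hf2 : MemLp f 2 μ := hf4.mono_exponent (by norm_num)
  have hf1 : Integrable f μ := hf2.integrable one_le_two
  induction k with
  | zero => simp [weightedWalk]
  | succ k ih =>
    have hwalk0 : ∫ ω, weightedWalk (fun i ω => f (R i ω)) V k ω j ∂P = 0 := by
      simp only [weightedWalk_apply]
      rw [integral_finsetSum _ fun i _ => memLp_one_iff_integrable.1
        (h.memLp_mul_V_apply (memLp_one_iff_integrable.2 (h.integrable_comp hf1 i)) j)]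
      simp [h.integral_comp_mul_V_apply hf, hf0]
    have hstep (ω : Ω) : weightedWalk (fun i ω => f (R i ω)) V (k + 1) ω j =
        f (R k ω) * V k ω j + weightedWalk (fun i ω => f (R i ω)) V k ω j := by
      simp [weightedWalk_succ, add_comm]
    simp only [hstep]
    rw [integral_pow_four_add_of_indepFun
      (h.indepFun_comp_mul_V_apply hf (h.measurable_weightedWalk_apply hf k j) j)
      (h.memLp_mul_V_apply (h.memLp_comp hf4 k) j) (h.memLp_weightedWalk_apply hf4 k j)
      (by rw [h.integral_comp_mul_V_apply hf, hf0, zero_mul]) hwalk0,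
      h.integral_comp_mul_V_apply_pow hf four_ne_zero,
      h.integral_comp_mul_V_apply_pow hf two_ne_zero, h.integral_weightedWalk_apply_sq hf hf2 hf0]
    have hsq : 0 ≤ ((∫ x, f x ^ 2 ∂μ) * (d : ℝ)⁻¹) ^ 2 := sq_nonneg _
    simp only [div_eq_mul_inv] at ih ⊢
    push_cast
    linarith

lemma integral_comp_mul_collisionSum_pow_four_le (h : IsAxisNoise P F μ R V) (hu : Measurable u)
    (hui : Integrable u μ) (hu0 : 0 ≤ ∫ x, u x ∂μ) (hf : Measurable f) (hf4 : MemLp f 4 μ)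
    (hf0 : ∫ x, f x ∂μ = 0) (k : ℕ) :
    ∫ ω, u (R k ω) * collisionSum (fun i ω => f (R i ω)) V k ω ^ 4 ∂P ≤
      (∫ x, u x ∂μ) * ((∫ x, f x ^ 4 ∂μ) * (k / d) + 3 * ((∫ x, f x ^ 2 ∂μ) * (k / d)) ^ 2) := by
  rw [h.integral_comp_mul_apply_collisionSum (φ := fun x => x ^ 4) hu hui hf (by fun_prop)
    fun j => integrable_pow_of_memLp_four (h.memLp_weightedWalk_apply hf4 k j) le_rfl]
  gcongr
  rcases eq_or_ne d 0 with rfl | hd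
  · simp
  calc (d : ℝ)⁻¹ * ∑ j, ∫ ω, weightedWalk (fun i ω => f (R i ω)) V k ω j ^ 4 ∂P
      ≤ (d : ℝ)⁻¹ * ∑ _j : Fin d,
          ((∫ x, f x ^ 4 ∂μ) * (k / d) + 3 * ((∫ x, f x ^ 2 ∂μ) * (k / d)) ^ 2) := by
        gcongr with j
        exact h.integral_weightedWalk_apply_pow_four_le hf hf4 hf0 k j
    _ = _ := by
        rw [Finset.sum_const, Finset.card_univ, Fintype.card_fin, nsmul_eq_mul,
          inv_mul_cancel_left₀ (by exact_mod_cast hd)]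

lemma integral_abs_norm_sq_weightedWalk_sub_le (h : IsAxisNoise P F μ R V) (hf : Measurable f)
    (hf4 : MemLp f 4 μ) (hf0 : ∫ x, f x ∂μ = 0) (n : ℕ) :
    ∫ ω, |‖weightedWalk (fun i ω => f (R i ω)) V n ω‖ ^ 2 - n * ∫ x, f x ^ 2 ∂μ| ∂P ≤
      √(n * ∫ x, (f x ^ 2 - ∫ y, f y ^ 2 ∂μ) ^ 2 ∂μ) +
        2 * √((∫ x, f x ^ 2 ∂μ) * (∫ x, f x ^ 2 ∂μ) * ((n : ℝ) ^ 2 / (2 * d))) := by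
  have := h.isProbabilityMeasure
  have hf2 : MemLp f 2 μ := hf4.mono_exponent (by norm_num)
  have hsq2 : MemLp (fun x => f x ^ 2 - ∫ y, f y ^ 2 ∂μ) 2 μ :=
    (memLp_two_sq_of_memLp_four hf4).sub (memLp_const _)
  have hsqmeas : Measurable fun x => f x ^ 2 - ∫ y, f y ^ 2 ∂μ := by fun_prop
  have hsq0 : ∫ x, (f x ^ 2 - ∫ y, f y ^ 2 ∂μ) ∂μ = 0 := by
    rw [integral_sub hf2.integrable_sq (integrable_const _)]
    simp
  have hsum2 : MemLp (fun ω => ∑ i ∈ Finset.range n, (f (R i ω) ^ 2 - ∫ y, f y ^ 2 ∂μ)) 2 P :=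
    memLp_finsetSum _ fun i _ => h.memLp_comp hsq2 i
  have hcross2 : MemLp (fun ω => ∑ i ∈ Finset.range n,
      f (R i ω) * collisionSum (fun i ω => f (R i ω)) V i ω) 2 P :=
    memLp_finsetSum _ fun i _ => h.memLp_comp_mul_collisionSum two_ne_zero hf hf2 hf hf2 i
  have hsum1 := (hsum2.integrable one_le_two).abs
  have hcross1 := (hcross2.integrable one_le_two).abs.const_mul 2
  refine (integral_mono_of_nonneg (ae_of_all _ fun ω => abs_nonneg _) (hsum1.add hcross1)
    ?_).trans ?_
  · filter_upwards [h.ae_norm_sq_weightedWalk_sub (fun i ω => f (R i ω)) (∫ x, f x ^ 2 ∂μ) n]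
      with ω hω
    exact (congrArg abs hω).trans_le ((abs_add_le _ _).trans_eq (by simp [abs_mul]))
  refine (integral_add hsum1 hcross1).trans_le ?_
  rw [integral_const_mul]
  gcongr
  · refine (integral_abs_le_sqrt hsum2).trans_eq ?_
    rw [h.integral_sum_comp_sq hsqmeas hsq2 hsq0]
  · exact (integral_abs_le_sqrt hcross2).trans
      (Real.sqrt_le_sqrt (h.integral_sum_comp_mul_collisionSum_sq_le hf hf2 hf0 hf hf2 hf0 n))

end IsAxisNoise

/-- The `k`-th increment of `a * ∑ k, ξ k + b * ∑ k, ∑ i < k, η i * η k * ⟪V i, V k⟫`, the form in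
which the fluctuations of the squared norm of a walk appear. -/
def quadraticIncrement {Ω G : Type*} [NormedAddCommGroup G] [InnerProductSpace ℝ G] (a b : ℝ)
    (ξ η : ℕ → Ω → ℝ) (V : ℕ → Ω → G) (k : ℕ) (ω : Ω) : ℝ :=
  a * ξ k ω + b * (η k ω * collisionSum η V k ω)

lemma IsMartingaleDifference.add {Ω : Type*} [mΩ : MeasurableSpace Ω] {P : Measure Ω}
    {F : Filtration ℕ mΩ} {X Y : ℕ → Ω → ℝ} (hX : IsMartingaleDifference P F X)
    (hY : IsMartingaleDifference P F Y) (hXi : ∀ k, Integrable (X k) P)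
    (hYi : ∀ k, Integrable (Y k) P) :
    IsMartingaleDifference P F fun k ω => X k ω + Y k ω where
  stronglyMeasurable k := (hX.stronglyMeasurable k).add (hY.stronglyMeasurable k)
  condExp_eq_zero k := by
    filter_upwards [condExp_add (hXi k) (hYi k) (F k), hX.condExp_eq_zero k,
      hY.condExp_eq_zero k] with ω hω hXω hYω
    exact hω.trans (by simp [hXω, hYω])

lemma condExp_mul_add_mul {Ω : Type*} {m mΩ : MeasurableSpace Ω} {P : Measure Ω}
    {X Y A B : Ω → ℝ} (hX : Integrable X P) (hY : Integrable Y P) (hXA : P[X | m] =ᵐ[P] A)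
    (hYB : P[Y | m] =ᵐ[P] B) (a b : ℝ) :
    P[fun ω => a * X ω + b * Y ω | m] =ᵐ[P] fun ω => a * A ω + b * B ω := by
  filter_upwards [condExp_add (hX.smul a) (hY.smul b) m, condExp_smul (μ := P) a X m,
    condExp_smul (μ := P) b Y m, hXA, hYB] with ω hadd hXω hYω hAω hBω
  refine hadd.trans ?_
  simp only [Pi.add_apply, Pi.smul_apply, smul_eq_mul] at hXω hYω ⊢
  rw [hXω, hYω, hAω, hBω]

namespace IsAxisNoise

variable {Ω E : Type*} [mΩ : MeasurableSpace Ω] [MeasurableSpace E] {P : Measure Ω}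
  {F : Filtration ℕ mΩ} {μ : Measure E} {d : ℕ} {R : ℕ → Ω → E}
  {V : ℕ → Ω → EuclideanSpace ℝ (Fin d)} {f g : E → ℝ}

lemma memLp_quadraticIncrement (h : IsAxisNoise P F μ R V) {p : ℕ} (hp : p ≠ 0)
    (hgp : MemLp g p μ) (hf : Measurable f) (hfp : MemLp f p μ) (a b : ℝ) (k : ℕ) :
    MemLp (quadraticIncrement a b (fun i ω => g (R i ω)) (fun i ω => f (R i ω)) V k) p P :=
  ((h.memLp_comp hgp k).const_mul a).add
    ((h.memLp_comp_mul_collisionSum hp hf hfp hf hfp k).const_mul b)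

variable [IsProbabilityMeasure P]

lemma isMartingaleDifference_quadraticIncrement (h : IsAxisNoise P F μ R V) (hg : Measurable g)
    (hgi : Integrable g μ) (hg0 : ∫ x, g x ∂μ = 0) (hf : Measurable f) (hfi : Integrable f μ)
    (hf0 : ∫ x, f x ∂μ = 0) (a b : ℝ) :
    IsMartingaleDifference P F
      (quadraticIncrement a b (fun i ω => g (R i ω)) (fun i ω => f (R i ω)) V) := by
  have hcross (k : ℕ) :=
    h.memLp_comp_mul_collisionSum one_ne_zero hf (by simpa using memLp_one_iff_integrable.2 hfi) hf
      (by simpa using memLp_one_iff_integrable.2 hfi) k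
  exact ((h.isMartingaleDifference_comp hg hg0).const_mul a).add
    ((h.isMartingaleDifference_comp_mul_collisionSum hf hfi hf0 hf hfi).const_mul b)
    (fun k => (h.integrable_comp hgi k).const_mul a)
    fun k => (memLp_one_iff_integrable.1 (by simpa using hcross k)).const_mul b

lemma integral_quadraticIncrement_pow_four_le (h : IsAxisNoise P F μ R V) (hg : Measurable g)
    (hg4 : MemLp g 4 μ) (hf : Measurable f) (hf4 : MemLp f 4 μ) (hf0 : ∫ x, f x ∂μ = 0)
    (a b : ℝ) (k : ℕ) :
    ∫ ω, quadraticIncrement a b (fun i ω => g (R i ω)) (fun i ω => f (R i ω)) V k ω ^ 4 ∂P ≤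
      8 * (a ^ 4 * ∫ x, g x ^ 4 ∂μ) + 8 * (b ^ 4 * ((∫ x, f x ^ 4 ∂μ) *
        ((∫ x, f x ^ 4 ∂μ) * (k / d) + 3 * ((∫ x, f x ^ 2 ∂μ) * (k / d)) ^ 2))) := by
  have := h.isProbabilityMeasure
  have hmark : Integrable (fun ω => 8 * (a ^ 4 * g (R k ω) ^ 4)) P :=
    ((integrable_pow_of_memLp_four (h.memLp_comp hg4 k) le_rfl).const_mul _).const_mul _
  have hcross : Integrable (fun ω => 8 * (b ^ 4 *
      (f (R k ω) ^ 4 * collisionSum (fun i ω => f (R i ω)) V k ω ^ 4))) P := by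
    simp only [← mul_pow (f _)]
    exact ((integrable_pow_of_memLp_four (h.memLp_comp_mul_collisionSum four_ne_zero hf hf4 hf
      hf4 k) le_rfl).const_mul _).const_mul _
  have hconvex (ω : Ω) :
      quadraticIncrement a b (fun i ω => g (R i ω)) (fun i ω => f (R i ω)) V k ω ^ 4 ≤
        8 * (a ^ 4 * g (R k ω) ^ 4) + 8 * (b ^ 4 *
          (f (R k ω) ^ 4 * collisionSum (fun i ω => f (R i ω)) V k ω ^ 4)) := by
    refine (Even.add_pow_le (by decide : Even 4)).trans_eq ?_
    ring
  refine (integral_mono_of_nonneg (ae_of_all _ fun ω => by positivity) (hmark.add hcross)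
    (ae_of_all _ hconvex)).trans ?_
  refine (integral_add hmark hcross).trans_le ?_
  simp only [integral_const_mul]
  rw [h.integral_comp (u := fun x => g x ^ 4) (by fun_prop) k]
  gcongr
  exact h.integral_comp_mul_collisionSum_pow_four_le (u := fun x => f x ^ 4) (by fun_prop)
    (integrable_pow_of_memLp_four hf4 le_rfl) (by positivity) hf hf4 hf0 k

lemma condExp_quadraticIncrement_sq (h : IsAxisNoise P F μ R V) (hg : Measurable g)
    (hg2 : MemLp g 2 μ) (hf : Measurable f) (hf2 : MemLp f 2 μ) (a b : ℝ) (k : ℕ) :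
    P[fun ω => quadraticIncrement a b (fun i ω => g (R i ω)) (fun i ω => f (R i ω)) V k ω ^ 2 | F k]
      =ᵐ[P] fun ω => a ^ 2 * ∫ x, g x ^ 2 ∂μ +
        2 * a * b * ((∫ x, g x * f x ∂μ) * ((d : ℝ)⁻¹ * ∑ i ∈ Finset.range k, f (R i ω))) +
        b ^ 2 * ((∫ x, f x ^ 2 ∂μ) *
          ((d : ℝ)⁻¹ * ‖weightedWalk (fun i ω => f (R i ω)) V k ω‖ ^ 2)) := by
  have := h.isProbabilityMeasure
  set C := collisionSum (fun i ω => f (R i ω)) V k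
  have hW (j : Fin d) := h.memLp_weightedWalk_apply hf2 k j
  have hgf : Integrable (fun x => g x * f x) μ := hg2.integrable_mul hf2
  have hmark := h.integrable_comp hg2.integrable_sq k
  have hmixed := h.integrable_comp_mul_apply_collisionSum (u := fun x => g x * f x)
    (φ := fun x => x) (by fun_prop) hgf hf measurable_id fun j => (hW j).integrable one_le_two
  have hcross := h.integrable_comp_mul_apply_collisionSum (u := fun x => f x ^ 2)
    (φ := fun x => x ^ 2) (by fun_prop) hf2.integrable_sq hf (by fun_prop)
    fun j => (hW j).integrable_sq
  have hmark_condExp := h.condExp_comp (u := fun x => g x ^ 2) (by fun_prop) k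
  have hmixed_condExp := h.condExp_comp_mul_apply_collisionSum (u := fun x => g x * f x)
    (φ := fun x => x) (by fun_prop) hgf hf measurable_id fun j => (hW j).integrable one_le_two
  have hcross_condExp := h.condExp_comp_mul_apply_collisionSum (u := fun x => f x ^ 2)
    (φ := fun x => x ^ 2) (by fun_prop) hf2.integrable_sq hf (by fun_prop)
    fun j => (hW j).integrable_sq
  have hexpand (ω : Ω) :
      quadraticIncrement a b (fun i ω => g (R i ω)) (fun i ω => f (R i ω)) V k ω ^ 2 =
        1 * (a ^ 2 * g (R k ω) ^ 2 + 2 * a * b * (g (R k ω) * f (R k ω) * C ω)) +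
          b ^ 2 * (f (R k ω) ^ 2 * C ω ^ 2) := by
    rw [quadraticIncrement]
    ring
  simp only [hexpand]
  filter_upwards [condExp_mul_add_mul ((hmark.const_mul _).fun_add (hmixed.const_mul _)) hcross
      (condExp_mul_add_mul hmark hmixed hmark_condExp hmixed_condExp (a ^ 2) (2 * a * b))
      hcross_condExp 1 (b ^ 2),
    h.ae_sum_weightedWalk_apply (fun i ω => f (R i ω)) k] with ω hω hsum
  rw [hω, hsum, one_mul, EuclideanSpace.real_norm_sq_eq]

lemma integral_quadraticIncrement_sq (h : IsAxisNoise P F μ R V) (hg : Measurable g)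
    (hg2 : MemLp g 2 μ) (hf : Measurable f) (hf2 : MemLp f 2 μ) (hf0 : ∫ x, f x ∂μ = 0)
    (a b : ℝ) (k : ℕ) :
    ∫ ω, quadraticIncrement a b (fun i ω => g (R i ω)) (fun i ω => f (R i ω)) V k ω ^ 2 ∂P =
      a ^ 2 * ∫ x, g x ^ 2 ∂μ + b ^ 2 * ((∫ x, f x ^ 2 ∂μ) ^ 2 * (k / d)) := by
  have := h.isProbabilityMeasure
  have hsum (i : ℕ) : Integrable (fun ω => f (R i ω)) P :=
    h.integrable_comp (hf2.integrable one_le_two) i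
  have hwalk : Integrable (fun ω => ‖weightedWalk (fun i ω => f (R i ω)) V k ω‖ ^ 2) P := by
    simp only [EuclideanSpace.real_norm_sq_eq]
    exact integrable_finsetSum _ fun j _ => (h.memLp_weightedWalk_apply hf2 k j).integrable_sq
  have hlinear : Integrable (fun ω => 2 * a * b *
      ((∫ x, g x * f x ∂μ) * ((d : ℝ)⁻¹ * ∑ i ∈ Finset.range k, f (R i ω)))) P :=
    (((integrable_finsetSum _ fun i _ => hsum i).const_mul _).const_mul _).const_mul _
  rw [← integral_condExp (F.le k),
    integral_congr_ae (h.condExp_quadraticIncrement_sq hg hg2 hf hf2 a b k),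
    integral_add ((integrable_const _).fun_add hlinear)
      (((hwalk.const_mul _).const_mul _).const_mul _),
    integral_add (integrable_const _) hlinear]
  simp only [integral_const_mul, integral_finsetSum _ fun i _ => hsum i,
    h.integral_comp hf.aestronglyMeasurable, hf0, h.integral_norm_sq_weightedWalk hf hf2 hf0,
    integral_const, probReal_univ, Finset.sum_const_zero, mul_zero, add_zero, one_smul]
  ring

lemma condExp_quadraticIncrement_sq_sub_integral (h : IsAxisNoise P F μ R V) (hg : Measurable g)
    (hg2 : MemLp g 2 μ) (hf : Measurable f) (hf2 : MemLp f 2 μ) (hf0 : ∫ x, f x ∂μ = 0)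
    (a b : ℝ) (k : ℕ) :
    P[fun ω => quadraticIncrement a b (fun i ω => g (R i ω)) (fun i ω => f (R i ω)) V k ω ^ 2 -
        ∫ ω, quadraticIncrement a b (fun i ω => g (R i ω)) (fun i ω => f (R i ω)) V k ω ^ 2 ∂P |
        F k] =ᵐ[P] fun ω =>
        2 * a * b * (∫ x, g x * f x ∂μ) * (d : ℝ)⁻¹ * ∑ i ∈ Finset.range k, f (R i ω) +
        b ^ 2 * (∫ x, f x ^ 2 ∂μ) * (d : ℝ)⁻¹ *
          (‖weightedWalk (fun i ω => f (R i ω)) V k ω‖ ^ 2 - k * ∫ x, f x ^ 2 ∂μ) := by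
  filter_upwards [condExp_sub
      (h.memLp_quadraticIncrement two_ne_zero hg2 hf hf2 a b k).integrable_sq
      (integrable_const (∫ ω, quadraticIncrement a b (fun i ω => g (R i ω))
        (fun i ω => f (R i ω)) V k ω ^ 2 ∂P)) (F k),
    h.condExp_quadraticIncrement_sq hg hg2 hf hf2 a b k] with ω hsub hsq
  refine hsub.trans ?_
  rw [Pi.sub_apply, hsq, condExp_const (F.le k),
    h.integral_quadraticIncrement_sq hg hg2 hf hf2 hf0]
  ring

lemma integral_abs_condExp_quadraticIncrement_sq_sub_integral_le (h : IsAxisNoise P F μ R V)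
    (hg : Measurable g) (hg2 : MemLp g 2 μ) (hf : Measurable f) (hf4 : MemLp f 4 μ)
    (hf0 : ∫ x, f x ∂μ = 0) (a b : ℝ) (k : ℕ) :
    ∫ ω, |P[fun ω =>
        quadraticIncrement a b (fun i ω => g (R i ω)) (fun i ω => f (R i ω)) V k ω ^ 2 -
        ∫ ω, quadraticIncrement a b (fun i ω => g (R i ω)) (fun i ω => f (R i ω)) V k ω ^ 2 ∂P
          | F k] ω| ∂P ≤
      |2 * a * b * (∫ x, g x * f x ∂μ) * (d : ℝ)⁻¹| * √(k * ∫ x, f x ^ 2 ∂μ) +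
        b ^ 2 * (∫ x, f x ^ 2 ∂μ) * (d : ℝ)⁻¹ *
          (√(k * ∫ x, (f x ^ 2 - ∫ y, f y ^ 2 ∂μ) ^ 2 ∂μ) +
            2 * √((∫ x, f x ^ 2 ∂μ) * (∫ x, f x ^ 2 ∂μ) * ((k : ℝ) ^ 2 / (2 * d)))) := by
  have := h.isProbabilityMeasure
  have hf2 : MemLp f 2 μ := hf4.mono_exponent (by norm_num)
  have hcoef : 0 ≤ b ^ 2 * (∫ x, f x ^ 2 ∂μ) * (d : ℝ)⁻¹ := by positivity
  have hsum : MemLp (fun ω => ∑ i ∈ Finset.range k, f (R i ω)) 2 P :=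
    memLp_finsetSum _ fun i _ => h.memLp_comp hf2 i
  have hwalk : Integrable (fun ω => ‖weightedWalk (fun i ω => f (R i ω)) V k ω‖ ^ 2) P := by
    simp only [EuclideanSpace.real_norm_sq_eq]
    exact integrable_finsetSum _ fun j _ => (h.memLp_weightedWalk_apply hf2 k j).integrable_sq
  have hsum_abs := ((hsum.integrable one_le_two).abs.const_mul
    |2 * a * b * (∫ x, g x * f x ∂μ) * (d : ℝ)⁻¹|)
  have hwalk_abs := ((hwalk.sub (integrable_const (k * ∫ x, f x ^ 2 ∂μ))).abs.const_mul
    (b ^ 2 * (∫ x, f x ^ 2 ∂μ) * (d : ℝ)⁻¹))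
  refine (integral_mono_of_nonneg (ae_of_all _ fun ω => abs_nonneg _)
    (hsum_abs.add hwalk_abs) ?_).trans ?_
  · filter_upwards [h.condExp_quadraticIncrement_sq_sub_integral hg hg2 hf hf2 hf0 a b k] with ω hω
    rw [hω]
    refine (abs_add_le _ _).trans_eq ?_
    rw [abs_mul, abs_mul (b ^ 2 * _ * _), abs_of_nonneg hcoef]
    rfl
  · refine (integral_add hsum_abs hwalk_abs).trans_le ?_
    simp only [integral_const_mul]
    gcongr
    · exact (integral_abs_le_sqrt hsum).trans_eq (by rw [h.integral_sum_comp_sq hf hf2 hf0])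
    · exact h.integral_abs_norm_sq_weightedWalk_sub_le hf hf4 hf0 k

end IsAxisNoise

section QuadraticCLT

variable {Ω E : Type*} [mΩ : MeasurableSpace Ω] [MeasurableSpace E] {P : Measure Ω}
  [IsProbabilityMeasure P] {μ : Measure E} {f g : E → ℝ}

namespace IsAxisNoise

variable {F : Filtration ℕ mΩ} {d : ℕ} {R : ℕ → Ω → E} {V : ℕ → Ω → EuclideanSpace ℝ (Fin d)}

lemma sum_integral_quadraticIncrement_sq (h : IsAxisNoise P F μ R V) (hg : Measurable g)
    (hg2 : MemLp g 2 μ) (hf : Measurable f) (hf2 : MemLp f 2 μ) (hf0 : ∫ x, f x ∂μ = 0)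
    (a b : ℝ) (n : ℕ) :
    ∑ k ∈ Finset.range n, ∫ ω,
        quadraticIncrement a b (fun i ω => g (R i ω)) (fun i ω => f (R i ω)) V k ω ^ 2 ∂P =
      n * a ^ 2 * (∫ x, g x ^ 2 ∂μ) +
        (n ^ 2 * b ^ 2 / d - n * b ^ 2 / d) * ((∫ x, f x ^ 2 ∂μ) ^ 2 / 2) := by
  simp only [h.integral_quadraticIncrement_sq hg hg2 hf hf2 hf0, Finset.sum_add_distrib,
    Finset.sum_const, Finset.card_range, nsmul_eq_mul, ← Finset.mul_sum, ← Finset.sum_div,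
    sum_range_cast]
  ring

lemma sum_integral_quadraticIncrement_pow_four_le (h : IsAxisNoise P F μ R V) (hg : Measurable g)
    (hg4 : MemLp g 4 μ) (hf : Measurable f) (hf4 : MemLp f 4 μ) (hf0 : ∫ x, f x ∂μ = 0)
    (a b : ℝ) (n : ℕ) :
    ∑ k ∈ Finset.range n, ∫ ω,
        quadraticIncrement a b (fun i ω => g (R i ω)) (fun i ω => f (R i ω)) V k ω ^ 4 ∂P ≤
      8 * (∫ x, g x ^ 4 ∂μ) * (n * a ^ 4) + 8 * (∫ x, f x ^ 4 ∂μ) *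
        ((∫ x, f x ^ 4 ∂μ) * (n ^ 2 * b ^ 4 / d) +
          3 * (∫ x, f x ^ 2 ∂μ) ^ 2 * (n ^ 3 * b ^ 4 / d ^ 2)) := by
  have := h.isProbabilityMeasure
  refine (Finset.sum_le_card_nsmul _ _ (8 * (a ^ 4 * ∫ x, g x ^ 4 ∂μ) +
    8 * (b ^ 4 * ((∫ x, f x ^ 4 ∂μ) * ((∫ x, f x ^ 4 ∂μ) * (n / d) +
      3 * ((∫ x, f x ^ 2 ∂μ) * (n / d)) ^ 2)))) fun k hk => ?_).trans_eq ?_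
  · have hkn : k ≤ n := (Finset.mem_range.1 hk).le
    refine (h.integral_quadraticIncrement_pow_four_le hg hg4 hf hf4 hf0 a b k).trans ?_
    gcongr
  · rw [Finset.card_range, nsmul_eq_mul]
    ring

lemma sum_integral_abs_condExp_quadraticIncrement_sq_sub_integral_le
    (h : IsAxisNoise P F μ R V) (hg : Measurable g) (hg2 : MemLp g 2 μ) (hf : Measurable f)
    (hf4 : MemLp f 4 μ) (hf0 : ∫ x, f x ∂μ = 0) (a b : ℝ) (n : ℕ) :
    ∑ k ∈ Finset.range n, ∫ ω, |P[fun ω =>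
        quadraticIncrement a b (fun i ω => g (R i ω)) (fun i ω => f (R i ω)) V k ω ^ 2 -
        ∫ ω, quadraticIncrement a b (fun i ω => g (R i ω)) (fun i ω => f (R i ω)) V k ω ^ 2 ∂P
          | F k] ω| ∂P ≤
      2 * |∫ x, g x * f x ∂μ| * √(∫ x, f x ^ 2 ∂μ) *
          √(n * a ^ 2 * (n ^ 2 * b ^ 2 / d) * (d : ℝ)⁻¹) +
        (∫ x, f x ^ 2 ∂μ) * (n ^ 2 * b ^ 2 / d) *
          (√(∫ x, (f x ^ 2 - ∫ y, f y ^ 2 ∂μ) ^ 2 ∂μ) * √((n : ℝ)⁻¹) +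
            2 * (∫ x, f x ^ 2 ∂μ) * √((2 * d : ℝ)⁻¹)) := by
  refine (Finset.sum_le_card_nsmul _ _
    (|2 * a * b * (∫ x, g x * f x ∂μ) * (d : ℝ)⁻¹| * √(n * ∫ x, f x ^ 2 ∂μ) +
      b ^ 2 * (∫ x, f x ^ 2 ∂μ) * (d : ℝ)⁻¹ *
        (√(n * ∫ x, (f x ^ 2 - ∫ y, f y ^ 2 ∂μ) ^ 2 ∂μ) +
          2 * √((∫ x, f x ^ 2 ∂μ) * (∫ x, f x ^ 2 ∂μ) * ((n : ℝ) ^ 2 / (2 * d)))))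
    fun k hk => ?_).trans_eq ?_
  · have hkn : k ≤ n := (Finset.mem_range.1 hk).le
    refine (h.integral_abs_condExp_quadraticIncrement_sq_sub_integral_le hg hg2 hf hf4 hf0
      a b k).trans ?_
    gcongr
  · have hmoment : 0 ≤ ∫ x, f x ^ 2 ∂μ := by positivity
    have hscale :
        n * a ^ 2 * (n ^ 2 * b ^ 2 / d) * (d : ℝ)⁻¹ = n * (n * a * b * (d : ℝ)⁻¹) ^ 2 := by ring
    have hinv : n ^ 2 * √((n : ℝ)⁻¹) = n * √n := by
      rw [Real.sqrt_inv, ← div_eq_mul_inv, pow_two, mul_div_assoc, Real.div_sqrt]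
    rw [Finset.card_range, nsmul_eq_mul, hscale, div_eq_mul_inv ((n : ℝ) ^ 2) (2 * d),
      Real.sqrt_mul n.cast_nonneg, Real.sqrt_mul n.cast_nonneg, Real.sqrt_mul n.cast_nonneg,
      Real.sqrt_sq_eq_abs, Real.sqrt_mul (by positivity), Real.sqrt_mul_self hmoment,
      Real.sqrt_mul (sq_nonneg (n : ℝ)), Real.sqrt_sq n.cast_nonneg]
    simp only [abs_mul, abs_two, Nat.abs_cast]
    linear_combination (-(b ^ 2 / d * (∫ x, f x ^ 2 ∂μ) *
      √(∫ x, (f x ^ 2 - ∫ y, f y ^ 2 ∂μ) ^ 2 ∂μ))) * hinv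

end IsAxisNoise

variable {ι : Type*} {l : Filter ι} {F : ι → Filtration ℕ mΩ} {d n : ι → ℕ}
  {R : ι → ℕ → Ω → E} {V : ∀ i, ℕ → Ω → EuclideanSpace ℝ (Fin (d i))} {a b : ι → ℝ} {A B : ℝ}

lemma tendsto_sum_integral_quadraticIncrement_sq
    (h : ∀ᶠ i in l, IsAxisNoise P (F i) μ (R i) (V i)) (hn : Tendsto n l atTop)
    (ha : Tendsto (fun i => n i * a i ^ 2) l (𝓝 A))
    (hb : Tendsto (fun i => (n i : ℝ) ^ 2 * b i ^ 2 / d i) l (𝓝 B)) (hg : Measurable g)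
    (hg2 : MemLp g 2 μ) (hf : Measurable f) (hf2 : MemLp f 2 μ) (hf0 : ∫ x, f x ∂μ = 0) :
    Tendsto (fun i => ∑ k ∈ Finset.range (n i), ∫ ω, quadraticIncrement (a i) (b i)
        (fun j ω => g (R i j ω)) (fun j ω => f (R i j ω)) (V i) k ω ^ 2 ∂P) l
      (𝓝 (A * (∫ x, g x ^ 2 ∂μ) + B * ((∫ x, f x ^ 2 ∂μ) ^ 2 / 2))) := by
  have hdiag : Tendsto (fun i => n i * b i ^ 2 / d i) l (𝓝 0) := by
    have := hb.mul (tendsto_inv_atTop_nhds_zero_nat.comp hn)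
    rw [mul_zero] at this
    refine this.congr' ?_
    filter_upwards [hn.eventually_ne_atTop 0] with i hi
    have : (n i : ℝ) ≠ 0 := by exact_mod_cast hi
    simp only [Function.comp_apply]
    field_simp
  have hlim := (ha.mul_const (∫ x, g x ^ 2 ∂μ)).add
    ((hb.sub hdiag).mul_const ((∫ x, f x ^ 2 ∂μ) ^ 2 / 2))
  rw [sub_zero] at hlim
  refine hlim.congr' ?_
  filter_upwards [h] with i hi
  exact (hi.sum_integral_quadraticIncrement_sq hg hg2 hf hf2 hf0 (a i) (b i) (n i)).symm

lemma tendsto_sum_integral_quadraticIncrement_pow_four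
    (h : ∀ᶠ i in l, IsAxisNoise P (F i) μ (R i) (V i)) (hn : Tendsto n l atTop)
    (hb0 : Tendsto b l (𝓝 0)) (ha : Tendsto (fun i => n i * a i ^ 2) l (𝓝 A))
    (hb : Tendsto (fun i => (n i : ℝ) ^ 2 * b i ^ 2 / d i) l (𝓝 B)) (hg : Measurable g)
    (hg4 : MemLp g 4 μ) (hf : Measurable f) (hf4 : MemLp f 4 μ) (hf0 : ∫ x, f x ∂μ = 0) :
    Tendsto (fun i => ∑ k ∈ Finset.range (n i), ∫ ω, quadraticIncrement (a i) (b i)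
        (fun j ω => g (R i j ω)) (fun j ω => f (R i j ω)) (V i) k ω ^ 4 ∂P) l (𝓝 0) := by
  have hninv : Tendsto (fun i => (n i : ℝ)⁻¹) l (𝓝 0) := tendsto_inv_atTop_nhds_zero_nat.comp hn
  have hn0 : ∀ᶠ i in l, (n i : ℝ) ≠ 0 :=
    (hn.eventually_ne_atTop 0).mono fun i hi => by exact_mod_cast hi
  have hmark : Tendsto (fun i => n i * a i ^ 4) l (𝓝 0) := by
    have := (ha.pow 2).mul hninv
    rw [mul_zero] at this
    refine this.congr' (hn0.mono fun i hi => ?_)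
    field_simp
  have hsparse : Tendsto (fun i => (n i : ℝ) ^ 2 * b i ^ 4 / d i) l (𝓝 0) := by
    have := hb.mul (hb0.pow 2)
    rw [zero_pow two_ne_zero, mul_zero] at this
    exact this.congr fun i => by ring
  have hdense : Tendsto (fun i => (n i : ℝ) ^ 3 * b i ^ 4 / (d i : ℝ) ^ 2) l (𝓝 0) := by
    have := (hb.pow 2).mul hninv
    rw [mul_zero] at this
    refine this.congr' (hn0.mono fun i hi => ?_)
    field_simp
  have hlim := (hmark.const_mul (8 * ∫ x, g x ^ 4 ∂μ)).add
    (((hsparse.const_mul (∫ x, f x ^ 4 ∂μ)).add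
      (hdense.const_mul (3 * (∫ x, f x ^ 2 ∂μ) ^ 2))).const_mul (8 * ∫ x, f x ^ 4 ∂μ))
  simp only [mul_zero, add_zero] at hlim
  refine squeeze_zero' (Eventually.of_forall fun i => by positivity) ?_ hlim
  filter_upwards [h] with i hi
  exact hi.sum_integral_quadraticIncrement_pow_four_le hg hg4 hf hf4 hf0 (a i) (b i) (n i)

lemma tendsto_sum_integral_abs_condExp_quadraticIncrement_sq_sub_integral
    (h : ∀ᶠ i in l, IsAxisNoise P (F i) μ (R i) (V i)) (hn : Tendsto n l atTop)
    (hd : Tendsto d l atTop) (ha : Tendsto (fun i => n i * a i ^ 2) l (𝓝 A))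
    (hb : Tendsto (fun i => (n i : ℝ) ^ 2 * b i ^ 2 / d i) l (𝓝 B)) (hg : Measurable g)
    (hg2 : MemLp g 2 μ) (hf : Measurable f) (hf4 : MemLp f 4 μ) (hf0 : ∫ x, f x ∂μ = 0) :
    Tendsto (fun i => ∑ k ∈ Finset.range (n i), ∫ ω, |P[fun ω => quadraticIncrement (a i) (b i)
          (fun j ω => g (R i j ω)) (fun j ω => f (R i j ω)) (V i) k ω ^ 2 -
        ∫ ω, quadraticIncrement (a i) (b i)
          (fun j ω => g (R i j ω)) (fun j ω => f (R i j ω)) (V i) k ω ^ 2 ∂P | F i k] ω| ∂P)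
      l (𝓝 0) := by
  have hninv : Tendsto (fun i => √(n i : ℝ)⁻¹) l (𝓝 0) := by
    simpa using (tendsto_inv_atTop_nhds_zero_nat.comp hn).sqrt
  have hdinv : Tendsto (fun i => (d i : ℝ)⁻¹) l (𝓝 0) := tendsto_inv_atTop_nhds_zero_nat.comp hd
  have hdinv2 : Tendsto (fun i => √(2 * d i : ℝ)⁻¹) l (𝓝 0) := by
    simpa [mul_inv] using (hdinv.mul_const 2⁻¹).sqrt
  have hlim := ((((ha.mul hb).mul hdinv).sqrt).const_mul
      (2 * |∫ x, g x * f x ∂μ| * √(∫ x, f x ^ 2 ∂μ))).add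
    ((hb.const_mul (∫ x, f x ^ 2 ∂μ)).mul
      ((hninv.const_mul √(∫ x, (f x ^ 2 - ∫ y, f y ^ 2 ∂μ) ^ 2 ∂μ)).add
        (hdinv2.const_mul (2 * ∫ x, f x ^ 2 ∂μ))))
  simp only [mul_zero, add_zero, Real.sqrt_zero] at hlim
  refine squeeze_zero' (Eventually.of_forall fun i => by positivity) ?_ hlim
  filter_upwards [h] with i hi
  exact hi.sum_integral_abs_condExp_quadraticIncrement_sq_sub_integral_le hg hg2 hf hf4 hf0
    (a i) (b i) (n i)

lemma tendsto_integral_exp_mul_sum_quadraticIncrement_of_memLp_four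
    (h : ∀ᶠ i in l, IsAxisNoise P (F i) μ (R i) (V i)) (hn : Tendsto n l atTop)
    (hd : Tendsto d l atTop) (hb0 : Tendsto b l (𝓝 0))
    (ha : Tendsto (fun i => n i * a i ^ 2) l (𝓝 A))
    (hb : Tendsto (fun i => (n i : ℝ) ^ 2 * b i ^ 2 / d i) l (𝓝 B)) (hg : Measurable g)
    (hg4 : MemLp g 4 μ) (hg0 : ∫ x, g x ∂μ = 0) (hf : Measurable f) (hf4 : MemLp f 4 μ)
    (hf0 : ∫ x, f x ∂μ = 0) (t : ℝ) :
    Tendsto (fun i => ∫ ω, Complex.exp ((t * ∑ k ∈ Finset.range (n i),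
        quadraticIncrement (a i) (b i) (fun j ω => g (R i j ω)) (fun j ω => f (R i j ω)) (V i) k ω :
          ℝ) * Complex.I) ∂P) l
      (𝓝 (Real.exp (-(t ^ 2 *
        (A * (∫ x, g x ^ 2 ∂μ) + B * ((∫ x, f x ^ 2 ∂μ) ^ 2 / 2)) / 2)) : ℂ)) := by
  rcases l.eq_or_neBot with rfl | _
  · exact tendsto_bot
  have : IsProbabilityMeasure μ := h.exists.choose_spec.isProbabilityMeasure
  have hg2 : MemLp g 2 μ := hg4.mono_exponent (by norm_num)
  have hf2 : MemLp f 2 μ := hf4.mono_exponent (by norm_num)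
  refine tendsto_integral_exp_mul_sum_of_isMartingaleDifference ?_ ?_
    (tendsto_sum_integral_quadraticIncrement_sq h hn ha hb hg hg2 hf hf2 hf0)
    (tendsto_sum_integral_abs_condExp_quadraticIncrement_sq_sub_integral h hn hd ha hb hg hg2
      hf hf4 hf0)
    (tendsto_sum_integral_quadraticIncrement_pow_four h hn hb0 ha hb hg hg4 hf hf4 hf0) t
  · filter_upwards [h] with i hi
    exact hi.isMartingaleDifference_quadraticIncrement hg (hg2.integrable one_le_two) hg0 hf
      (hf2.integrable one_le_two) hf0 (a i) (b i)
  · filter_upwards [h] with i hi k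
    exact hi.memLp_quadraticIncrement four_ne_zero hg4 hf hf4 (a i) (b i) k

end QuadraticCLT

section Truncation

lemma abs_sub_truncation_le {E : Type*} (f : E → ℝ) (c : ℝ) (x : E) :
    |f x - truncation f c x| ≤ |f x| := by
  simp only [truncation, Set.indicator, Function.comp_apply, id_eq]
  split_ifs <;> simp

variable {E : Type*} [MeasurableSpace E] {μ : Measure E} {f : E → ℝ}

/-- The truncation of `f` at level `c`, shifted so as to have mean zero under `μ`. -/
def centeredTruncation (μ : Measure E) (f : E → ℝ) (c : ℝ) (x : E) : ℝ :=
  truncation f c x - ∫ y, truncation f c y ∂μ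

lemma measurable_truncation (hf : Measurable f) (c : ℝ) : Measurable (truncation f c) :=
  (measurable_id.indicator measurableSet_Ioc).comp hf

lemma measurable_centeredTruncation (hf : Measurable f) (c : ℝ) :
    Measurable (centeredTruncation μ f c) :=
  (measurable_truncation hf c).sub_const _

lemma tendsto_integral_sub_truncation_sq (hf : Measurable f) (hf2 : MemLp f 2 μ) :
    Tendsto (fun c => ∫ x, (f x - truncation f c x) ^ 2 ∂μ) atTop (𝓝 0) := by
  rw [← integral_zero E ℝ (μ := μ)]
  refine tendsto_integral_filter_of_dominated_convergence (fun x => f x ^ 2)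
    (Eventually.of_forall fun c =>
      ((hf.sub (measurable_truncation hf c)).pow_const 2).aestronglyMeasurable)
    (Eventually.of_forall fun c => ae_of_all _ fun x => ?_) hf2.integrable_sq
    (ae_of_all _ fun x => ?_)
  · rw [Real.norm_eq_abs, abs_of_nonneg (sq_nonneg _)]
    exact sq_le_sq.2 (abs_sub_truncation_le f c x)
  · refine tendsto_const_nhds.congr' ?_
    filter_upwards [eventually_gt_atTop |f x|] with c hc
    simp [truncation_eq_self hc]

variable [IsProbabilityMeasure μ]

lemma memLp_centeredTruncation (hf : Measurable f) (c : ℝ) (p : ENNReal) :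
    MemLp (centeredTruncation μ f c) p μ :=
  hf.aestronglyMeasurable.memLp_truncation.sub (memLp_const _)

lemma integral_centeredTruncation (hf : Measurable f) (c : ℝ) :
    ∫ x, centeredTruncation μ f c x ∂μ = 0 := by
  simp only [centeredTruncation]
  rw [integral_sub hf.aestronglyMeasurable.integrable_truncation (integrable_const _)]
  simp

lemma tendsto_integral_sub_centeredTruncation_sq (hf : Measurable f) (hf2 : MemLp f 2 μ)
    (hf0 : ∫ x, f x ∂μ = 0) :
    Tendsto (fun c => ∫ x, (f x - centeredTruncation μ f c x) ^ 2 ∂μ) atTop (𝓝 0) := by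
  refine squeeze_zero (fun c => integral_nonneg fun x => sq_nonneg _) (fun c => ?_)
    (tendsto_integral_sub_truncation_sq hf hf2)
  have hmeas := hf.sub (measurable_truncation hf c)
  have hvar := variance_le_expectation_sq (μ := μ) hmeas.aestronglyMeasurable
  rw [variance_eq_integral hmeas.aemeasurable] at hvar
  refine le_of_eq_of_le (integral_congr_ae (ae_of_all _ fun x => ?_)) hvar
  simp only [Pi.sub_apply, centeredTruncation]
  rw [integral_sub (hf2.integrable one_le_two) hf.aestronglyMeasurable.integrable_truncation, hf0]
  ring

end Truncation

lemma tendsto_integral_sq_of_tendsto_integral_sub_sq {E ι : Type*} [MeasurableSpace E]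
    {μ : Measure E} {l : Filter ι} {f : E → ℝ} {f' : ι → E → ℝ} (hf : MemLp f 2 μ)
    (hf' : ∀ i, MemLp (f' i) 2 μ)
    (hlim : Tendsto (fun i => ∫ x, (f x - f' i x) ^ 2 ∂μ) l (𝓝 0)) :
    Tendsto (fun i => ∫ x, f' i x ^ 2 ∂μ) l (𝓝 (∫ x, f x ^ 2 ∂μ)) := by
  have hcross : Tendsto (fun i => ∫ x, f x * (f x - f' i x) ∂μ) l (𝓝 0) := by
    refine squeeze_zero_norm (fun i => (norm_integral_le_integral_norm _).trans
      (integral_abs_mul_le_sqrt_mul_sqrt hf (hf.sub (hf' i)))) ?_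
    simpa using hlim.sqrt.const_mul √(∫ x, f x ^ 2 ∂μ)
  have hexpand (i : ι) : ∫ x, f' i x ^ 2 ∂μ =
      ∫ x, f x ^ 2 ∂μ - 2 * ∫ x, f x * (f x - f' i x) ∂μ + ∫ x, (f x - f' i x) ^ 2 ∂μ := by
    have hprod : Integrable (fun x => f x * (f x - f' i x)) μ := hf.integrable_mul (hf.sub (hf' i))
    have hsq : Integrable (fun x => (f x - f' i x) ^ 2) μ := (hf.sub (hf' i)).integrable_sq
    rw [← integral_const_mul, ← integral_sub hf.integrable_sq (hprod.const_mul 2),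
      ← integral_add (Integrable.sub' hf.integrable_sq (hprod.const_mul 2)) hsq]
    congr with x
    ring
  simp only [hexpand]
  simpa using (tendsto_const_nhds.sub (hcross.const_mul 2)).add hlim

section CharFun

variable {Ω : Type*} [MeasurableSpace Ω] {P : Measure Ω} {X Y : Ω → ℝ}

lemma norm_exp_mul_I_sub_exp_mul_I_le (x y : ℝ) :
    ‖Complex.exp (x * Complex.I) - Complex.exp (y * Complex.I)‖ ≤ |x - y| := by
  have hfactor : Complex.exp (x * Complex.I) - Complex.exp (y * Complex.I) =
      Complex.exp (y * Complex.I) * (Complex.exp (Complex.I * (x - y : ℝ)) - 1) := by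
    rw [mul_sub, ← Complex.exp_add, mul_one]
    push_cast
    ring_nf
  rw [hfactor, norm_mul, Complex.norm_exp_ofReal_mul_I, one_mul]
  exact Real.norm_exp_I_mul_ofReal_sub_one_le

lemma norm_integral_exp_mul_sub_le [IsProbabilityMeasure P] (hX : MemLp X 2 P)
    (hY : MemLp Y 2 P) (t : ℝ) :
    ‖∫ ω, Complex.exp ((t * X ω : ℝ) * Complex.I) ∂P -
      ∫ ω, Complex.exp ((t * Y ω : ℝ) * Complex.I) ∂P‖ ≤ |t| * √(∫ ω, (X ω - Y ω) ^ 2 ∂P) := by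
  have hint {Z : Ω → ℝ} (hZ : MemLp Z 2 P) :
      Integrable (fun ω => Complex.exp ((t * Z ω : ℝ) * Complex.I)) P := by
    have := hZ.1.aemeasurable
    exact Integrable.of_bound (AEMeasurable.aestronglyMeasurable (by fun_prop)) 1
      (ae_of_all _ fun ω => (Complex.norm_exp_ofReal_mul_I _).le)
  rw [← integral_sub (hint hX) (hint hY)]
  calc ‖∫ ω, (Complex.exp ((t * X ω : ℝ) * Complex.I) -
          Complex.exp ((t * Y ω : ℝ) * Complex.I)) ∂P‖
      ≤ ∫ ω, |t| * |X ω - Y ω| ∂P := by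
        refine norm_integral_le_of_norm_le
          (((hX.sub hY).integrable one_le_two).abs.const_mul _) (ae_of_all _ fun ω => ?_)
        rw [← abs_mul, mul_sub]
        exact norm_exp_mul_I_sub_exp_mul_I_le _ _
    _ ≤ |t| * √(∫ ω, (X ω - Y ω) ^ 2 ∂P) := by
        rw [integral_const_mul]
        gcongr
        exact integral_abs_le_sqrt (hX.sub hY)

end CharFun

section Approximation

lemma sum_quadraticIncrement_sub {Ω : Type*} {d : ℕ} (a b : ℝ) (ξ ξ' η η' : ℕ → Ω → ℝ)
    (V : ℕ → Ω → EuclideanSpace ℝ (Fin d)) (n : ℕ) (ω : Ω) :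
    ∑ k ∈ Finset.range n, quadraticIncrement a b ξ η V k ω -
        ∑ k ∈ Finset.range n, quadraticIncrement a b ξ' η' V k ω =
      a * ∑ k ∈ Finset.range n, (ξ k ω - ξ' k ω) +
        b * ∑ k ∈ Finset.range n, (η k ω - η' k ω) * collisionSum η V k ω +
        b * ∑ k ∈ Finset.range n,
          η' k ω * collisionSum (fun i ω => η i ω - η' i ω) V k ω := by
  simp only [← Finset.sum_sub_distrib, Finset.mul_sum, ← Finset.sum_add_distrib,
    quadraticIncrement, collisionSum_sub]
  exact Finset.sum_congr rfl fun k _ => by ring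

lemma integral_add_add_sq_le {Ω : Type*} [MeasurableSpace Ω] {P : Measure Ω} {X Y Z : Ω → ℝ}
    (hX : MemLp X 2 P) (hY : MemLp Y 2 P) (hZ : MemLp Z 2 P) :
    ∫ ω, (X ω + Y ω + Z ω) ^ 2 ∂P ≤
      3 * (∫ ω, X ω ^ 2 ∂P + ∫ ω, Y ω ^ 2 ∂P + ∫ ω, Z ω ^ 2 ∂P) := by
  have hXY := hX.integrable_sq.fun_add hY.integrable_sq
  rw [← integral_add hX.integrable_sq hY.integrable_sq, ← integral_add hXY hZ.integrable_sq,
    ← integral_const_mul]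
  refine integral_mono_of_nonneg (ae_of_all _ fun ω => sq_nonneg _)
    ((hXY.fun_add hZ.integrable_sq).const_mul 3) (ae_of_all _ fun ω => ?_)
  nlinarith [sq_nonneg (X ω - Y ω), sq_nonneg (X ω - Z ω), sq_nonneg (Y ω - Z ω)]

variable {Ω E : Type*} [mΩ : MeasurableSpace Ω] [MeasurableSpace E] {P : Measure Ω}
  [IsProbabilityMeasure P] {μ : Measure E} {f g f' g' : E → ℝ}

lemma IsAxisNoise.integral_sum_quadraticIncrement_sub_sq_le {F : Filtration ℕ mΩ} {d : ℕ}
    {R : ℕ → Ω → E} {V : ℕ → Ω → EuclideanSpace ℝ (Fin d)} (h : IsAxisNoise P F μ R V)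
    (hg : Measurable g) (hg2 : MemLp g 2 μ) (hg0 : ∫ x, g x ∂μ = 0)
    (hg' : Measurable g') (hg'2 : MemLp g' 2 μ) (hg'0 : ∫ x, g' x ∂μ = 0)
    (hf : Measurable f) (hf2 : MemLp f 2 μ) (hf0 : ∫ x, f x ∂μ = 0)
    (hf' : Measurable f') (hf'2 : MemLp f' 2 μ) (hf'0 : ∫ x, f' x ∂μ = 0) (a b : ℝ) (n : ℕ) :
    ∫ ω, (∑ k ∈ Finset.range n,
          quadraticIncrement a b (fun i ω => g (R i ω)) (fun i ω => f (R i ω)) V k ω -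
        ∑ k ∈ Finset.range n,
          quadraticIncrement a b (fun i ω => g' (R i ω)) (fun i ω => f' (R i ω)) V k ω) ^ 2 ∂P ≤
      3 * (n * a ^ 2 * (∫ x, (g x - g' x) ^ 2 ∂μ) + n ^ 2 * b ^ 2 / d *
        ((∫ x, (f x - f' x) ^ 2 ∂μ) * (∫ x, f x ^ 2 ∂μ + ∫ x, f' x ^ 2 ∂μ) / 2)) := by
  have := h.isProbabilityMeasure
  have hcentered {u v : E → ℝ} (hu : MemLp u 2 μ) (hv : MemLp v 2 μ) (hu0 : ∫ x, u x ∂μ = 0)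
      (hv0 : ∫ x, v x ∂μ = 0) : ∫ x, (u x - v x) ∂μ = 0 := by
    rw [integral_sub (hu.integrable one_le_two) (hv.integrable one_le_two), hu0, hv0, sub_zero]
  have hS : MemLp (fun ω => ∑ k ∈ Finset.range n, (g (R k ω) - g' (R k ω))) 2 P :=
    memLp_finsetSum _ fun k _ => h.memLp_comp (hg2.sub hg'2) k
  have hT : MemLp (fun ω => ∑ k ∈ Finset.range n,
      (f (R k ω) - f' (R k ω)) * collisionSum (fun i ω => f (R i ω)) V k ω) 2 P :=
    memLp_finsetSum _ fun k _ => h.memLp_comp_mul_collisionSum (u := fun x => f x - f' x)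
      two_ne_zero (hf.sub hf') (hf2.sub hf'2) hf hf2 k
  have hU : MemLp (fun ω => ∑ k ∈ Finset.range n,
      f' (R k ω) * collisionSum (fun i ω => f (R i ω) - f' (R i ω)) V k ω) 2 P :=
    memLp_finsetSum _ fun k _ => h.memLp_comp_mul_collisionSum (f := fun x => f x - f' x)
      two_ne_zero hf' hf'2 (hf.sub hf') (hf2.sub hf'2) k
  simp only [sum_quadraticIncrement_sub]
  refine (integral_add_add_sq_le (hS.const_mul a) (hT.const_mul b) (hU.const_mul b)).trans ?_
  simp only [mul_pow, integral_const_mul]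
  have hSeq := h.integral_sum_comp_sq (u := fun x => g x - g' x) (hg.sub hg') (hg2.sub hg'2)
    (hcentered hg2 hg'2 hg0 hg'0) n
  have hTle := h.integral_sum_comp_mul_collisionSum_sq_le (u := fun x => f x - f' x) (hf.sub hf')
    (hf2.sub hf'2) (hcentered hf2 hf'2 hf0 hf'0) hf hf2 hf0 n
  have hUle := h.integral_sum_comp_mul_collisionSum_sq_le (f := fun x => f x - f' x) hf' hf'2 hf'0
    (hf.sub hf') (hf2.sub hf'2) (hcentered hf2 hf'2 hf0 hf'0) n
  linear_combination 3 * a ^ 2 * hSeq + 3 * b ^ 2 * hTle + 3 * b ^ 2 * hUle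

variable {ι : Type*} {l : Filter ι} {F : ι → Filtration ℕ mΩ} {d n : ι → ℕ}
  {R : ι → ℕ → Ω → E} {V : ∀ i, ℕ → Ω → EuclideanSpace ℝ (Fin (d i))} {a b : ι → ℝ} {A B : ℝ}

lemma tendstoUniformlyOnFilter_integral_exp_mul_sum_quadraticIncrement
    (h : ∀ᶠ i in l, IsAxisNoise P (F i) μ (R i) (V i))
    (ha : Tendsto (fun i => n i * a i ^ 2) l (𝓝 A))
    (hb : Tendsto (fun i => (n i : ℝ) ^ 2 * b i ^ 2 / d i) l (𝓝 B)) (hg : Measurable g)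
    (hg2 : MemLp g 2 μ) (hg0 : ∫ x, g x ∂μ = 0) (hf : Measurable f) (hf2 : MemLp f 2 μ)
    (hf0 : ∫ x, f x ∂μ = 0) {gc fc : ℝ → E → ℝ} (hgc : ∀ c, Measurable (gc c))
    (hgc2 : ∀ c, MemLp (gc c) 2 μ) (hgc0 : ∀ c, ∫ x, gc c x ∂μ = 0) (hfc : ∀ c, Measurable (fc c))
    (hfc2 : ∀ c, MemLp (fc c) 2 μ) (hfc0 : ∀ c, ∫ x, fc c x ∂μ = 0)
    (hgerr : Tendsto (fun c => ∫ x, (g x - gc c x) ^ 2 ∂μ) atTop (𝓝 0))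
    (hferr : Tendsto (fun c => ∫ x, (f x - fc c x) ^ 2 ∂μ) atTop (𝓝 0)) (t : ℝ) :
    TendstoUniformlyOnFilter (fun c i => ∫ ω, Complex.exp ((t * ∑ k ∈ Finset.range (n i),
        quadraticIncrement (a i) (b i) (fun j ω => gc c (R i j ω)) (fun j ω => fc c (R i j ω))
          (V i) k ω : ℝ) * Complex.I) ∂P)
      (fun i => ∫ ω, Complex.exp ((t * ∑ k ∈ Finset.range (n i),
        quadraticIncrement (a i) (b i) (fun j ω => g (R i j ω)) (fun j ω => f (R i j ω))
          (V i) k ω : ℝ) * Complex.I) ∂P) atTop l := by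
  have hflim := tendsto_integral_sq_of_tendsto_integral_sub_sq hf2 hfc2 hferr
  have herr : Tendsto (fun p : ℝ × ι => |t| * √(3 * (n p.2 * a p.2 ^ 2 *
      (∫ x, (g x - gc p.1 x) ^ 2 ∂μ) + n p.2 ^ 2 * b p.2 ^ 2 / d p.2 *
        ((∫ x, (f x - fc p.1 x) ^ 2 ∂μ) * (∫ x, f x ^ 2 ∂μ + ∫ x, fc p.1 x ^ 2 ∂μ) / 2))))
      (atTop ×ˢ l) (𝓝 0) := by
    have hga := (ha.comp tendsto_snd).mul (hgerr.comp tendsto_fst)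
    have hfb := (hb.comp tendsto_snd).mul (((hferr.comp tendsto_fst).mul
      ((hflim.comp tendsto_fst).const_add (∫ x, f x ^ 2 ∂μ))).div_const 2)
    simpa using ((hga.add hfb).const_mul 3).sqrt.const_mul |t|
  rw [Metric.tendstoUniformlyOnFilter_iff]
  intro ε hε
  filter_upwards [herr.eventually (gt_mem_nhds hε), h.prod_inr atTop] with p hp hnoise
  rw [dist_eq_norm]
  refine ((norm_integral_exp_mul_sub_le (memLp_finsetSum _ fun k _ =>
    hnoise.memLp_quadraticIncrement two_ne_zero hg2 hf hf2 _ _ k) (memLp_finsetSum _ fun k _ =>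
    hnoise.memLp_quadraticIncrement two_ne_zero (hgc2 _) (hfc _) (hfc2 _) _ _ k) t).trans
      ?_).trans_lt hp
  gcongr
  exact hnoise.integral_sum_quadraticIncrement_sub_sq_le hg hg2 hg0 (hgc _) (hgc2 _) (hgc0 _)
    hf hf2 hf0 (hfc _) (hfc2 _) (hfc0 _) _ _ _

theorem tendsto_integral_exp_mul_sum_quadraticIncrement
    (h : ∀ᶠ i in l, IsAxisNoise P (F i) μ (R i) (V i)) (hn : Tendsto n l atTop)
    (hd : Tendsto d l atTop) (hb0 : Tendsto b l (𝓝 0))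
    (ha : Tendsto (fun i => n i * a i ^ 2) l (𝓝 A))
    (hb : Tendsto (fun i => (n i : ℝ) ^ 2 * b i ^ 2 / d i) l (𝓝 B)) (hg : Measurable g)
    (hg2 : MemLp g 2 μ) (hg0 : ∫ x, g x ∂μ = 0) (hf : Measurable f) (hf2 : MemLp f 2 μ)
    (hf0 : ∫ x, f x ∂μ = 0) (t : ℝ) :
    Tendsto (fun i => ∫ ω, Complex.exp ((t * ∑ k ∈ Finset.range (n i),
        quadraticIncrement (a i) (b i) (fun j ω => g (R i j ω)) (fun j ω => f (R i j ω)) (V i) k ω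
          : ℝ) * Complex.I) ∂P) l
      (𝓝 (Real.exp (-(t ^ 2 *
        (A * (∫ x, g x ^ 2 ∂μ) + B * ((∫ x, f x ^ 2 ∂μ) ^ 2 / 2)) / 2)) : ℂ)) := by
  rcases l.eq_or_neBot with rfl | hl
  · exact tendsto_bot
  obtain ⟨i₀, hi₀⟩ := h.exists
  have := hi₀.isProbabilityMeasure
  have hgc (c : ℝ) := measurable_centeredTruncation (μ := μ) hg c
  have hfc (c : ℝ) := measurable_centeredTruncation (μ := μ) hf c
  have hgc0 (c : ℝ) := integral_centeredTruncation (μ := μ) hg c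
  have hfc0 (c : ℝ) := integral_centeredTruncation (μ := μ) hf c
  have hgc2 (c : ℝ) := memLp_centeredTruncation (μ := μ) hg c 2
  have hfc2 (c : ℝ) := memLp_centeredTruncation (μ := μ) hf c 2
  have hgerr := tendsto_integral_sub_centeredTruncation_sq hg hg2 hg0
  have hferr := tendsto_integral_sub_centeredTruncation_sq hf hf2 hf0
  have hglim := tendsto_integral_sq_of_tendsto_integral_sub_sq hg2 hgc2 hgerr
  have hflim := tendsto_integral_sq_of_tendsto_integral_sub_sq hf2 hfc2 hferr
  refine TendstoUniformlyOnFilter.tendsto_of_eventually_tendsto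
    (tendstoUniformlyOnFilter_integral_exp_mul_sum_quadraticIncrement h ha hb hg hg2 hg0 hf hf2 hf0
      hgc hgc2 hgc0 hfc hfc2 hfc0 hgerr hferr t)
    (Eventually.of_forall fun c => tendsto_integral_exp_mul_sum_quadraticIncrement_of_memLp_four
      h hn hd hb0 ha hb (hgc c) (memLp_centeredTruncation hg c 4) (hgc0 c) (hfc c)
      (memLp_centeredTruncation hf c 4) (hfc0 c) t) ?_
  have hvar := (hglim.const_mul A).add (((hflim.pow 2).div_const 2).const_mul B)
  exact (Complex.continuous_ofReal.tendsto _).comp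
    ((Real.continuous_exp.tendsto _).comp ((hvar.const_mul (t ^ 2)).div_const 2).neg)

end Approximation

section SlowVariation

variable {f : ℝ → ℝ}

lemma eventually_volume_setOf_le_abs_add_sub_lt (hf : Measurable f)
    (h : ∀ v, Tendsto (fun u => f (u + v) - f u) atTop (𝓝 0)) {w : ℕ → ℝ}
    (hw : Tendsto w atTop atTop) {K : Set ℝ} (hK : volume K ≠ ⊤) {ε : ℝ} (hε : 0 < ε)
    {δ : ENNReal} (hδ : 0 < δ) :
    ∀ᶠ N in atTop, volume {y ∈ K | ε ≤ |f (w N + y) - f (w N)|} < δ := by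
  have : IsFiniteMeasure (volume.restrict K) := isFiniteMeasure_restrict.2 hK
  have hm : TendstoInMeasure (volume.restrict K) (fun N y => f (w N + y) - f (w N)) atTop 0 :=
    tendstoInMeasure_of_tendsto_ae
      (fun N => Measurable.aestronglyMeasurable (by fun_prop)) (ae_of_all _ fun y => (h y).comp hw)
  filter_upwards [(tendstoInMeasure_iff_norm.1 hm ε hε).eventually_lt_const hδ] with N hN
  refine lt_of_le_of_lt (le_of_eq ?_) hN
  rw [Measure.restrict_apply (measurableSet_le measurable_const (by fun_prop))]
  congr 1
  ext y
  simp [and_comm]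

lemma exists_abs_add_sub_lt_of_volume_lt {u v ε : ℝ} (hv : v ∈ Set.Icc (0 : ℝ) 1)
    (hu : volume {y ∈ Set.Icc (0 : ℝ) 2 | ε ≤ |f (u + y) - f u|} < ENNReal.ofReal (1 / 2))
    (huv : volume {y ∈ Set.Icc (0 : ℝ) 2 | ε ≤ |f (u + v + y) - f (u + v)|} <
      ENNReal.ofReal (1 / 2)) :
    ∃ y, |f (u + y) - f u| < ε ∧ |f (u + y) - f (u + v)| < ε := by
  set S := {y ∈ Set.Icc (0 : ℝ) 2 | ε ≤ |f (u + y) - f u|}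
  set T := {y ∈ Set.Icc (0 : ℝ) 2 | ε ≤ |f (u + v + y) - f (u + v)|}
  -- `[1, 2]` lies in both `[0, 2]` and `v + [0, 2]`, and the two exceptional sets do not cover it.
  have hlt : volume (S ∪ (fun y => y - v) ⁻¹' T) < volume (Set.Icc (1 : ℝ) 2) := by
    calc volume (S ∪ (fun y => y - v) ⁻¹' T)
        ≤ volume S + volume ((fun y => y - v) ⁻¹' T) := measure_union_le _ _
      _ = volume S + volume T := by simp only [sub_eq_add_neg, measure_preimage_add_right]
      _ < ENNReal.ofReal (1 / 2) + ENNReal.ofReal (1 / 2) := ENNReal.add_lt_add hu huv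
      _ = volume (Set.Icc (1 : ℝ) 2) := by
        rw [← ENNReal.ofReal_add (by norm_num) (by norm_num), Real.volume_Icc]
        norm_num
  obtain ⟨y, hy, hyST⟩ := Set.not_subset.1 fun hsub => (measure_mono hsub).not_gt hlt
  obtain ⟨hyS, hyT⟩ := not_or.1 hyST
  refine ⟨y, lt_of_not_ge fun hge => hyS ⟨⟨by linarith [hy.1], hy.2⟩, hge⟩,
    lt_of_not_ge fun hge => hyT ⟨⟨by linarith [hy.1, hv.2], by linarith [hy.2, hv.1]⟩, ?_⟩⟩
  rwa [add_assoc, add_sub_cancel]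

lemma eventually_forall_abs_add_sub_le (hf : Measurable f)
    (h : ∀ v, Tendsto (fun u => f (u + v) - f u) atTop (𝓝 0)) {ε : ℝ} (hε : 0 < ε) :
    ∀ᶠ u in atTop, ∀ v ∈ Set.Icc (0 : ℝ) 1, |f (u + v) - f u| ≤ ε := by
  by_contra hcon
  rw [eventually_atTop] at hcon
  push Not at hcon
  choose u hu v hv huv using fun N : ℕ => hcon N
  have hut : Tendsto u atTop atTop := tendsto_atTop_mono hu tendsto_natCast_atTop_atTop
  have huvt : Tendsto (fun N => u N + v N) atTop atTop :=
    tendsto_atTop_mono (fun N => le_add_of_nonneg_right (hv N).1) hut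
  have hsmall {w : ℕ → ℝ} (hw : Tendsto w atTop atTop) :=
    eventually_volume_setOf_le_abs_add_sub_lt hf h hw (K := Set.Icc 0 2) measure_Icc_lt_top.ne
      (half_pos hε) (δ := ENNReal.ofReal (1 / 2)) (by simp)
  obtain ⟨N, hN, hN'⟩ := ((hsmall hut).and (hsmall huvt)).exists
  obtain ⟨y, hy, hy'⟩ := exists_abs_add_sub_lt_of_volume_lt (hv N) hN hN'
  rw [abs_sub_comm] at hy'
  linarith [huv N, abs_sub_le (f (u N + v N)) (f (u N + y)) (f (u N))]

lemma abs_sub_le_natCast_mul {U ε : ℝ}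
    (hU : ∀ u ≥ U, ∀ v ∈ Set.Icc (0 : ℝ) 1, |f (u + v) - f u| ≤ ε) (k : ℕ) :
    ∀ u ∈ Set.Icc U (U + k), |f u - f U| ≤ k * ε := by
  have hε : 0 ≤ ε := (abs_nonneg _).trans (hU U le_rfl 0 (by simp))
  induction k with
  | zero =>
    intro u hu
    have huU : u = U := le_antisymm (by simpa using hu.2) hu.1
    simp [huU]
  | succ k ih =>
    intro u hu
    push_cast at hu ⊢
    rcases le_total u (U + 1) with hle | hge
    · have hfirst := hU U le_rfl (u - U) ⟨by linarith [hu.1], by linarith⟩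
      rw [add_sub_cancel] at hfirst
      nlinarith [mul_nonneg k.cast_nonneg hε]
    · have hprev := ih (u - 1) ⟨by linarith, by linarith [hu.2]⟩
      have hlast := hU (u - 1) (by linarith) 1 ⟨zero_le_one, le_rfl⟩
      rw [sub_add_cancel] at hlast
      linarith [abs_sub_le (f u) (f (u - 1)) (f U)]

lemma isLittleO_id_of_tendsto_add_sub (hf : Measurable f)
    (h : ∀ v, Tendsto (fun u => f (u + v) - f u) atTop (𝓝 0)) : f =o[atTop] (id : ℝ → ℝ) := by
  refine isLittleO_iff.2 fun ε hε => ?_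
  obtain ⟨U, hU⟩ := eventually_atTop.1 (eventually_forall_abs_add_sub_le hf h (half_pos hε))
  filter_upwards [eventually_ge_atTop U, eventually_ge_atTop 0,
    (tendsto_id.const_mul_atTop (half_pos hε)).eventually_ge_atTop (|f U| + (1 - U) * (ε / 2))]
    with u huU hu0 hu
  have hceil : (⌈u - U⌉₊ : ℝ) ≤ u - U + 1 := (Nat.ceil_lt_add_one (sub_nonneg.2 huU)).le
  rw [id_eq] at hu ⊢
  rw [Real.norm_of_nonneg hu0]
  calc |f u| ≤ |f u - f U| + |f U| := sub_le_iff_le_add.1 (abs_sub_abs_le_abs_sub _ _)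
    _ ≤ ⌈u - U⌉₊ * (ε / 2) + |f U| := by
      gcongr
      exact abs_sub_le_natCast_mul hU _ u ⟨huU, by linarith [Nat.le_ceil (u - U)]⟩
    _ ≤ (u - U + 1) * (ε / 2) + |f U| := by gcongr
    _ ≤ ε * u := by linarith

lemma IsSlowlyVarying.tendsto_log_comp_exp_add_sub {L : ℝ → ℝ} (hL : IsSlowlyVarying L) (v : ℝ) :
    Tendsto (fun u => Real.log (L (Real.exp (u + v))) - Real.log (L (Real.exp u))) atTop
      (𝓝 0) := by
  have hratio := ((hL.tendsto_ratio (Real.exp v) (Real.exp_pos v)).comp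
    Real.tendsto_exp_atTop).log one_ne_zero
  rw [Real.log_one] at hratio
  have hpos := Real.tendsto_exp_atTop.eventually hL.eventually_pos
  refine hratio.congr' ?_
  filter_upwards [hpos, (tendsto_atTop_add_const_right atTop v tendsto_id).eventually hpos]
    with u hu huv
  rw [id_eq] at huv
  rw [← Real.log_div huv.ne' hu.ne', Function.comp_apply, ← Real.exp_add, add_comm v]

lemma IsSlowlyVarying.eventually_mem_Icc_rpow {L : ℝ → ℝ} (hL : IsSlowlyVarying L) {ε : ℝ}
    (hε : 0 < ε) : ∀ᶠ x in atTop, L x ∈ Set.Icc (x ^ (-ε)) (x ^ ε) := by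
  have hlog := (isLittleO_id_of_tendsto_add_sub
    (Real.measurable_log.comp (hL.measurable.comp Real.measurable_exp))
    hL.tendsto_log_comp_exp_add_sub).comp_tendsto Real.tendsto_log_atTop
  filter_upwards [isLittleO_iff.1 hlog hε, hL.eventually_pos, eventually_ge_atTop 1]
    with x hx hLx hx1
  have hx0 : 0 < x := one_pos.trans_le hx1
  simp only [Function.comp_apply, id_eq, Real.exp_log hx0,
    Real.norm_of_nonneg (Real.log_nonneg hx1), Real.norm_eq_abs, abs_le] at hx
  rw [Real.rpow_def_of_pos hx0, Real.rpow_def_of_pos hx0]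
  exact ⟨(Real.le_log_iff_exp_le hLx).1 (by linarith), (Real.log_le_iff_le_exp hLx).1 (by linarith)⟩

end SlowVariation

section Independence

variable {Ω ι κ : Type*} {mΩ : MeasurableSpace Ω} {P : Measure Ω}

lemma iIndep_sumElim {m : ι → MeasurableSpace Ω} {m' : κ → MeasurableSpace Ω} (h : iIndep m P)
    (h' : iIndep m' P) (hind : Indep (⨆ i, m i) (⨆ i, m' i) P) : iIndep (Sum.elim m m') P := by
  rw [iIndep_iff]
  intro s f hf
  have hsplit : (⋂ i ∈ s, f i) =
      (⋂ i ∈ s.toLeft, f (Sum.inl i)) ∩ ⋂ i ∈ s.toRight, f (Sum.inr i) := by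
    ext ω
    simp [Sum.forall]
  have hl : ∀ i ∈ s.toLeft, MeasurableSet[m i] (f (Sum.inl i)) := fun i hi =>
    hf _ (Finset.mem_toLeft.1 hi)
  have hr : ∀ i ∈ s.toRight, MeasurableSet[m' i] (f (Sum.inr i)) := fun i hi =>
    hf _ (Finset.mem_toRight.1 hi)
  rw [hsplit, (Indep_iff _ _ _).1 hind, h.meas_biInter hl, h'.meas_biInter hr,
    Finset.prod_sum_eq_prod_toLeft_mul_prod_toRight]
  · exact Finset.measurableSet_biInter _ fun i hi => le_iSup m i _ (hl i hi)
  · exact Finset.measurableSet_biInter _ fun i hi => le_iSup m' i _ (hr i hi)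

/-- The filtration generated by a sequence, shifted so that stage `k` knows only the terms with
index strictly less than `k` (unlike `Filtration.natural`). -/
def strictPast {β : Type*} [MeasurableSpace β] (X : ℕ → Ω → β) (hX : ∀ k, Measurable (X k)) :
    Filtration ℕ mΩ where
  seq k := ⨆ i ∈ Set.Iio k, MeasurableSpace.comap (X i) inferInstance
  mono' _ _ hkl := biSup_mono fun _ hi => lt_of_lt_of_le hi hkl
  le' _ := iSup₂_le fun i _ => (hX i).comap_le

lemma measurable_strictPast {β : Type*} [MeasurableSpace β] {X : ℕ → Ω → β}
    (hX : ∀ k, Measurable (X k)) (k : ℕ) : Measurable[strictPast X hX (k + 1)] (X k) :=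
  measurable_iff_comap_le.2 (le_iSup₂_of_le k k.lt_succ_self le_rfl)

lemma indep_comap_prodMk_strictPast {β γ : Type*} [MeasurableSpace β] [MeasurableSpace γ]
    {X : ℕ → Ω → β} {Y : ℕ → Ω → γ} (hX : ∀ k, Measurable (X k)) (hY : ∀ k, Measurable (Y k))
    (hXi : iIndepFun X P) (hYi : iIndepFun Y P)
    (hXY : IndepFun (fun ω i => X i ω) (fun ω i => Y i ω) P) (k : ℕ) :
    Indep (MeasurableSpace.comap (fun ω => (X k ω, Y k ω)) inferInstance)
      (strictPast (fun i ω => (X i ω, Y i ω)) (fun i => (hX i).prodMk (hY i)) k) P := by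
  set m : ℕ ⊕ ℕ → MeasurableSpace Ω :=
    Sum.elim (fun i => MeasurableSpace.comap (X i) inferInstance)
      (fun i => MeasurableSpace.comap (Y i) inferInstance)
  have hpair (i : ℕ) : MeasurableSpace.comap (fun ω => (X i ω, Y i ω)) inferInstance =
      m (Sum.inl i) ⊔ m (Sum.inr i) := MeasurableSpace.comap_prodMk _ _
  have hm : iIndep m P := iIndep_sumElim hXi hYi <|
    indep_of_indep_of_le_left (indep_of_indep_of_le_right hXY
      (iSup_le fun i => ((measurable_pi_apply i).comp
        (comap_measurable fun ω i => Y i ω)).comap_le))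
      (iSup_le fun i => ((measurable_pi_apply i).comp
        (comap_measurable fun ω i => X i ω)).comap_le)
  have hle : ∀ x, m x ≤ mΩ := Sum.rec (fun i => (hX i).comap_le) fun i => (hY i).comap_le
  have hdisj : Disjoint {Sum.inl k, Sum.inr k} {x : ℕ ⊕ ℕ | Sum.elim id id x < k} := by simp
  refine indep_of_indep_of_le_left (indep_of_indep_of_le_right
    (indep_iSup_of_disjoint hle hm hdisj) (iSup₂_le fun i hi => ?_)) ?_
  · rw [hpair]
    exact sup_le (le_iSup₂_of_le (Sum.inl i) hi le_rfl) (le_iSup₂_of_le (Sum.inr i) hi le_rfl)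
  · rw [hpair]
    exact sup_le (le_iSup₂_of_le (Sum.inl k) (by simp) le_rfl)
      (le_iSup₂_of_le (Sum.inr k) (by simp) le_rfl)

end Independence

lemma ae_eq_single_of_forall_measure_eq {Ω : Type*} [MeasurableSpace Ω] {P : Measure Ω}
    [IsProbabilityMeasure P] {d : ℕ} (hd : d ≠ 0) {V : Ω → EuclideanSpace ℝ (Fin d)}
    (hV : Measurable V)
    (h : ∀ j, P {ω | V ω = EuclideanSpace.single j (1 : ℝ)} = (d : ENNReal)⁻¹) :
    ∀ᵐ ω ∂P, ∃ j, V ω = EuclideanSpace.single j (1 : ℝ) := by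
  have hm (j : Fin d) : MeasurableSet {ω | V ω = EuclideanSpace.single j (1 : ℝ)} :=
    hV (measurableSet_singleton _)
  have hdisj : Pairwise fun i j : Fin d => Disjoint {ω | V ω = EuclideanSpace.single i (1 : ℝ)}
      {ω | V ω = EuclideanSpace.single j (1 : ℝ)} := by
    refine fun i j hij => Set.disjoint_left.2 fun ω hi hj => hij ?_
    simpa using congrArg (fun v => v i) ((show V ω = _ from hi).symm.trans hj)
  have hone : P (⋃ j : Fin d, {ω | V ω = EuclideanSpace.single j (1 : ℝ)}) = 1 := by
    rw [measure_iUnion hdisj hm, tsum_fintype]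
    simp only [h, Finset.sum_const, Finset.card_univ, Fintype.card_fin, nsmul_eq_mul]
    exact ENNReal.mul_inv_cancel (Nat.cast_ne_zero.2 hd) (ENNReal.natCast_ne_top d)
  filter_upwards [mem_ae_iff.2 ((prob_compl_eq_zero_iff (MeasurableSet.iUnion hm)).2 hone)]
    with ω hω
  simpa using hω

namespace IsAxisWalkModel

variable {Ω₀ Ω : Type*} [MeasurableSpace Ω₀] [MeasurableSpace Ω] {P₀ : Measure Ω₀} {P : Measure Ω}
  {R₀ : Ω₀ → ℝ} {R : ℕ → Ω → ℝ} {V : (d : ℕ) → ℕ → Ω → EuclideanSpace ℝ (Fin d)}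

lemma isAxisNoise [IsProbabilityMeasure P] (h : IsAxisWalkModel P₀ P R₀ R V) {d : ℕ} (hd : d ≠ 0) :
    IsAxisNoise P (strictPast (fun i ω => (R i ω, V d i ω))
      fun i => (h.measurable_R i).prodMk (h.measurable_V d i)) (P₀.map R₀) R (V d) where
  measurable_R k := measurable_fst.comp (measurable_strictPast _ k)
  measurable_V k := measurable_snd.comp (measurable_strictPast _ k)
  map_R k := (h.identDistrib_R k).map_eq
  ae_eq_single k := ae_eq_single_of_forall_measure_eq hd (h.measurable_V d k) (h.uniform_V d k)
  uniform_V k j := by simp [measureReal_def, h.uniform_V]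
  indep_R_V k := (h.indep_R_V d).comp (measurable_pi_apply k) (measurable_pi_apply k)
  indep_past k := indep_comap_prodMk_strictPast h.measurable_R (h.measurable_V d) h.indep_R
    (h.indep_V d) (h.indep_R_V d) k

lemma aemeasurable (h : IsAxisWalkModel P₀ P R₀ R V) : AEMeasurable R₀ P₀ :=
  (h.identDistrib_R 0).aemeasurable_snd

lemma memLp_two (h : IsAxisWalkModel P₀ P R₀ R V) : MemLp R₀ 2 P₀ := by
  rw [memLp_two_iff_integrable_sq h.aemeasurable.aestronglyMeasurable]
  by_contra hnot
  exact zero_ne_one ((integral_undef hnot).symm.trans h.second_moment)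

lemma memLp_id_map (h : IsAxisWalkModel P₀ P R₀ R V) : MemLp id 2 (P₀.map R₀) :=
  (memLp_map_measure_iff aestronglyMeasurable_id h.aemeasurable).2 h.memLp_two

lemma integral_id_map (h : IsAxisWalkModel P₀ P R₀ R V) : ∫ x, id x ∂(P₀.map R₀) = 0 :=
  (integral_map h.aemeasurable aestronglyMeasurable_id).trans h.mean_zero

lemma integral_id_sq_map (h : IsAxisWalkModel P₀ P R₀ R V) : ∫ x, id x ^ 2 ∂(P₀.map R₀) = 1 :=
  (integral_map h.aemeasurable (by fun_prop)).trans h.second_moment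

lemma measurable_axisWalk (h : IsAxisWalkModel P₀ P R₀ R V) (d n : ℕ) :
    Measurable (axisWalk R V d n) :=
  Finset.measurable_fun_sum _ fun i _ => (h.measurable_R i).smul (h.measurable_V d i)

lemma ae_norm_sq_axisWalk_sub [IsProbabilityMeasure P] (h : IsAxisWalkModel P₀ P R₀ R V) {d : ℕ}
    (hd : d ≠ 0) (n : ℕ) :
    ∀ᵐ ω ∂P, ‖axisWalk R V d n ω‖ ^ 2 - n = ∑ i ∈ Finset.range n, (R i ω ^ 2 - 1) +
      2 * ∑ i ∈ Finset.range n, R i ω * collisionSum R (V d) i ω := by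
  simpa only [mul_one] using! (h.isAxisNoise hd).ae_norm_sq_weightedWalk_sub R 1 n

end IsAxisWalkModel

section Law

variable {Ω : Type*} [MeasurableSpace Ω] {P : Measure Ω} [IsProbabilityMeasure P]
  {ν : Measure ℝ} [IsProbabilityMeasure ν] {X Y : ℕ → Ω → ℝ}

lemma convergesInLaw_of_tendsto_charFun (hX : ∀ d, AEMeasurable (X d) P)
    (h : ∀ t : ℝ, Tendsto (fun d => ∫ ω, Complex.exp ((t * X d ω : ℝ) * Complex.I) ∂P) atTop
      (𝓝 (charFun ν t))) : ConvergesInLaw P X ν where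
  forall_aemeasurable := hX
  aemeasurable_limit := aemeasurable_id
  tendsto := by
    refine ProbabilityMeasure.tendsto_of_tendsto_charFun fun t => ?_
    simp only [ProbabilityMeasure.coe_mk, Measure.map_id]
    refine (h t).congr fun d => ?_
    rw [charFun_apply_real, integral_map (hX d) (by fun_prop)]
    simp

lemma ConvergesInLaw.comp (h : ConvergesInLaw P X ν) {n : ℕ → ℕ} (hn : Tendsto n atTop atTop) :
    ConvergesInLaw P (fun d => X (n d)) ν where
  forall_aemeasurable d := h.forall_aemeasurable (n d)
  aemeasurable_limit := aemeasurable_id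
  tendsto := h.tendsto.comp hn

lemma ConvergesInLaw.add_tendstoInMeasure_zero {Z : ℕ → Ω → ℝ} (h : ConvergesInLaw P X ν)
    (hY : ∀ d, AEMeasurable (Y d) P) (hZ : TendstoInMeasure P Z atTop 0)
    (hYZ : ∀ᶠ d in atTop, Y d =ᵐ[P] X d + Z d) : ConvergesInLaw P Y ν := by
  refine tendstoInDistribution_of_tendstoInMeasure_sub Y id h (hZ.congr' ?_ EventuallyEq.rfl) hY
  filter_upwards [hYZ] with d hd
  filter_upwards [hd] with ω hω
  simp [hω]

lemma ConvergesInLaw.congr' (h : ConvergesInLaw P X ν) (hY : ∀ d, AEMeasurable (Y d) P)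
    (hXY : ∀ᶠ d in atTop, Y d =ᵐ[P] X d) : ConvergesInLaw P Y ν := by
  refine h.add_tendstoInMeasure_zero (Z := 0) hY ?_ (by simpa using hXY)
  exact tendstoInMeasure_of_tendsto_ae (fun _ => aestronglyMeasurable_zero)
    (ae_of_all _ fun _ => tendsto_const_nhds)

lemma ConvergesInLaw.tendstoInMeasure_zero (h : ConvergesInLaw P X (Measure.dirac 0)) :
    TendstoInMeasure P X atTop 0 := by
  rw [tendstoInMeasure_iff_norm]
  intro ε hε
  have hclosed : IsClosed {x : ℝ | ε ≤ ‖x‖} := isClosed_le continuous_const continuous_norm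
  have hnull : Measure.dirac (0 : ℝ) {x : ℝ | ε ≤ ‖x‖} = 0 := by
    rw [Measure.dirac_apply' _ hclosed.measurableSet]
    simpa using hε
  have hlim := ProbabilityMeasure.tendsto_measure_of_null_frontier_of_tendsto' h.tendsto
    (E := {x : ℝ | ε ≤ ‖x‖}) (by simpa using measure_mono_null hclosed.frontier_subset hnull)
  simp only [ProbabilityMeasure.coe_mk, Measure.map_id, hnull] at hlim
  refine hlim.congr fun d => ?_
  rw [Measure.map_apply_of_aemeasurable (h.forall_aemeasurable d) hclosed.measurableSet]
  simp

lemma ConvergesInLaw.tendstoInMeasure_mul (h : ConvergesInLaw P X ν) {r : ℕ → ℝ}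
    (hr : Tendsto r atTop (𝓝 0)) : TendstoInMeasure P (fun d ω => r d * X d ω) atTop 0 := by
  have hconst : TendstoInMeasure P (fun d (_ : Ω) => r d) atTop fun _ => 0 :=
    tendstoInMeasure_of_tendsto_ae (fun _ => aestronglyMeasurable_const) (ae_of_all _ fun _ => hr)
  have hprod := h.continuous_comp_prodMk_of_tendstoInMeasure_const
    (g := fun p : ℝ × ℝ => p.2 * p.1) (by fun_prop) hconst fun _ => aemeasurable_const
  refine ConvergesInLaw.tendstoInMeasure_zero
    ⟨hprod.forall_aemeasurable, aemeasurable_id, ?_⟩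
  simpa using hprod.tendsto

lemma tendstoInMeasure_zero_of_integral_sq (hX : ∀ᶠ d in atTop, MemLp (X d) 2 P)
    (h : Tendsto (fun d => ∫ ω, X d ω ^ 2 ∂P) atTop (𝓝 0)) : TendstoInMeasure P X atTop 0 := by
  rw [tendstoInMeasure_iff_measureReal_norm]
  intro ε hε
  refine squeeze_zero' (Eventually.of_forall fun d => measureReal_nonneg) ?_
    (by simpa using h.div_const (ε ^ 2))
  filter_upwards [hX] with d hd
  rw [le_div_iff₀ (by positivity), mul_comm]
  refine le_trans ?_ (mul_meas_ge_le_integral_of_nonneg (ae_of_all _ fun ω => sq_nonneg (X d ω))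
    hd.integrable_sq (ε ^ 2))
  refine mul_le_mul_of_nonneg_left (measureReal_mono fun ω hω => ?_) (sq_nonneg ε)
  simp only [Set.mem_ofPred_eq, Pi.zero_apply, sub_zero, Real.norm_eq_abs] at hω ⊢
  rw [← sq_abs (X d ω)]
  exact pow_le_pow_left₀ hε.le hω 2

end Law

section CriticalPower

variable {L : ℝ → ℝ}

lemma IsSlowlyVarying.tendsto_rpow_neg_mul_sq (hL : IsSlowlyVarying L) {η : ℝ} (hη : 0 < η) :
    Tendsto (fun x => x ^ (-η) * L x ^ 2) atTop (𝓝 0) := by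
  refine squeeze_zero' ?_ ?_ (tendsto_rpow_neg_atTop (half_pos hη))
  · filter_upwards [eventually_ge_atTop 0] with x hx
    positivity
  · filter_upwards [hL.eventually_mem_Icc_rpow (show 0 < η / 4 by positivity),
      hL.eventually_pos, eventually_gt_atTop 0] with x hLx hLx0 hx
    calc x ^ (-η) * L x ^ 2 ≤ x ^ (-η) * (x ^ (η / 4)) ^ 2 := by
          gcongr
          exact hLx.2
      _ = x ^ (-(η / 2)) := by
          rw [← Real.rpow_mul_natCast hx.le, ← Real.rpow_add hx]
          congr 1
          push_cast
          ring

lemma IsSlowlyVarying.tendsto_rpow_mul_sq_atTop (hL : IsSlowlyVarying L) {η : ℝ} (hη : 0 < η) :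
    Tendsto (fun x => x ^ η * L x ^ 2) atTop atTop := by
  refine tendsto_atTop_mono' _ ?_ (tendsto_rpow_atTop (half_pos hη))
  filter_upwards [hL.eventually_mem_Icc_rpow (show 0 < η / 4 by positivity), eventually_gt_atTop 0]
    with x hLx hx
  calc x ^ (η / 2) = x ^ η * (x ^ (-(η / 4))) ^ 2 := by
        rw [← Real.rpow_mul_natCast hx.le, ← Real.rpow_add hx]
        congr 1
        push_cast
        ring
    _ ≤ x ^ η * L x ^ 2 := by
        gcongr
        exact hLx.1

lemma rpow_mul_rpow_one_div_mul_sq {α x : ℝ} (hα : α ≠ 0) (hx : 0 < x) (κ r : ℝ) :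
    x ^ κ * (x ^ (1 / α) * r) ^ 2 / x ^ 2 = x ^ (κ - 1 / (α / (2 * α - 2))) * r ^ 2 := by
  have hexp : κ - 1 / (α / (2 * α - 2)) = κ + 1 / α * 2 - 2 := by
    field_simp
    ring
  rw [hexp, Real.rpow_sub hx, Real.rpow_add hx, Real.rpow_mul hx.le, Real.rpow_two, Real.rpow_two]
  ring

variable {ι : Type*} {l : Filter ι} {x y : ι → ℝ} {α δ : ℝ}

lemma IsSlowlyVarying.tendsto_mul_sq_div_sq_zero (hL : IsSlowlyVarying L) (hα : 1 < α)
    (hδ : 0 < δ) (hx : Tendsto x l atTop) (hy : Tendsto y l atTop)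
    (hyx : ∀ᶠ i in l, y i ^ (α / (2 * α - 2) + δ) < x i) :
    Tendsto (fun i => y i * (x i ^ (1 / α) * L (x i)) ^ 2 / x i ^ 2) l (𝓝 0) := by
  set β := α / (2 * α - 2)
  have hβ0 : 0 < β := div_pos (by linarith) (by linarith)
  have hη : 0 < 1 / β - 1 / (β + δ) :=
    sub_pos.2 (one_div_lt_one_div_of_lt hβ0 (by linarith))
  refine squeeze_zero' ?_ ?_ ((hL.tendsto_rpow_neg_mul_sq hη).comp hx)
  · filter_upwards [hy.eventually_ge_atTop 0] with i hyi
    positivity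
  · filter_upwards [hyx, hx.eventually_gt_atTop 0, hy.eventually_ge_atTop 0] with i hi hxi hyi
    have hyi' : y i ≤ x i ^ (1 / (β + δ)) := by
      rw [one_div]
      exact (Real.le_rpow_inv_iff_of_pos hyi hxi.le (by positivity)).2 hi.le
    calc y i * (x i ^ (1 / α) * L (x i)) ^ 2 / x i ^ 2
        ≤ x i ^ (1 / (β + δ)) * (x i ^ (1 / α) * L (x i)) ^ 2 / x i ^ 2 := by gcongr
      _ = x i ^ (-(1 / β - 1 / (β + δ))) * L (x i) ^ 2 := by
        rw [rpow_mul_rpow_one_div_mul_sq (by linarith) hxi, neg_sub]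

lemma IsSlowlyVarying.tendsto_mul_sq_div_sq_atTop (hL : IsSlowlyVarying L) (hα : 1 < α)
    (hδ : 0 < δ) (hx : Tendsto x l atTop) (hy : Tendsto y l atTop)
    (hxy : ∀ᶠ i in l, x i < y i ^ (α / (2 * α - 2) - δ)) :
    Tendsto (fun i => y i * (x i ^ (1 / α) * L (x i)) ^ 2 / x i ^ 2) l atTop := by
  set β := α / (2 * α - 2)
  have hβ0 : 0 < β := div_pos (by linarith) (by linarith)
  -- `β - δ` may be negative, in which case any exponent below `β` serves in its place.
  obtain ⟨κ, hκ0, hκβ, hκ⟩ : ∃ κ, 0 < κ ∧ κ < β ∧ β - δ ≤ κ :=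
    ⟨max (β - δ) (β / 2), lt_max_of_lt_right (by positivity), max_lt (by linarith) (by linarith),
      le_max_left _ _⟩
  have hη : 0 < 1 / κ - 1 / β := sub_pos.2 (one_div_lt_one_div_of_lt hκ0 hκβ)
  refine tendsto_atTop_mono' _ ?_ ((hL.tendsto_rpow_mul_sq_atTop hη).comp hx)
  filter_upwards [hxy, hx.eventually_gt_atTop 0, hy.eventually_ge_atTop 1] with i hi hxi hyi
  have hyi' : x i ^ (1 / κ) ≤ y i := by
    rw [one_div]
    exact (Real.rpow_inv_le_iff_of_pos hxi.le (by linarith) hκ0).2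
      (hi.le.trans (Real.rpow_le_rpow_of_exponent_le hyi hκ))
  calc x i ^ (1 / κ - 1 / β) * L (x i) ^ 2
      = x i ^ (1 / κ) * (x i ^ (1 / α) * L (x i)) ^ 2 / x i ^ 2 := by
        rw [rpow_mul_rpow_one_div_mul_sq (by linarith) hxi]
    _ ≤ y i * (x i ^ (1 / α) * L (x i)) ^ 2 / x i ^ 2 := by gcongr

lemma tendsto_sq_div_atTop_of_rpow_lt (hα : 1 < α) (hδ : 0 < δ) (hy : Tendsto y l atTop)
    (hyx : ∀ᶠ i in l, y i ^ (α / (2 * α - 2) + δ) < x i) :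
    Tendsto (fun i => x i ^ 2 / y i) l atTop := by
  have hhalf : 1 / 2 ≤ α / (2 * α - 2) := by
    rw [div_le_div_iff₀ two_pos (by linarith)]
    linarith
  refine tendsto_atTop_mono' _ ?_ ((tendsto_rpow_atTop (show 0 < 2 * δ by positivity)).comp hy)
  filter_upwards [hyx, hy.eventually_ge_atTop 1] with i hi hyi
  have hy0 : 0 < y i := by linarith
  rw [Function.comp_apply, le_div_iff₀ hy0]
  calc y i ^ (2 * δ) * y i = (y i ^ (1 / 2 + δ)) ^ 2 := by
        rw [← Real.rpow_mul_natCast hy0.le, ← Real.rpow_add_one hy0.ne']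
        congr 1
        push_cast
        ring
    _ ≤ (y i ^ (α / (2 * α - 2) + δ)) ^ 2 := by gcongr
    _ ≤ x i ^ 2 := by gcongr

end CriticalPower

section Rates

variable {n : ℕ → ℕ}

lemma tendsto_sqrt_two_mul_atTop (h : Tendsto (fun d : ℕ => (n d : ℝ) ^ 2 / d) atTop atTop) :
    Tendsto (fun d : ℕ => √(2 * (n d : ℝ) ^ 2 / d)) atTop atTop := by
  refine Real.tendsto_sqrt_atTop.comp ((h.const_mul_atTop two_pos).congr fun d => ?_)
  ring

lemma tendsto_sq_div_sqrt_two_mul_sq_div (hn : Tendsto (fun d => (n d : ℝ)) atTop atTop) :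
    Tendsto (fun d : ℕ => (n d : ℝ) ^ 2 / √(2 * (n d : ℝ) ^ 2 / d) ^ 2 / d) atTop (𝓝 (1 / 2)) := by
  refine tendsto_const_nhds.congr' ?_
  filter_upwards [hn.eventually_gt_atTop 0, eventually_gt_atTop 0] with d hnd hd
  have : (0 : ℝ) < d := Nat.cast_pos.2 hd
  rw [Real.sq_sqrt (by positivity)]
  field_simp

lemma IsSlowlyVarying.tendsto_rpow_mul_div_sqrt_zero {L : ℝ → ℝ} (hL : IsSlowlyVarying L) {α δ : ℝ}
    (hα : 1 < α) (hδ : 0 < δ) (hn : Tendsto (fun d => (n d : ℝ)) atTop atTop)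
    (hlt : ∀ᶠ d : ℕ in atTop, (d : ℝ) ^ (α / (2 * α - 2) + δ) < n d) :
    Tendsto (fun d : ℕ => (n d : ℝ) ^ (1 / α) * L (n d) / √(2 * (n d : ℝ) ^ 2 / d)) atTop
      (𝓝 0) := by
  have hsq := ((hL.tendsto_mul_sq_div_sq_zero hα hδ hn tendsto_natCast_atTop_atTop
    hlt).div_const 2).sqrt
  rw [zero_div, Real.sqrt_zero] at hsq
  refine (tendsto_zero_iff_abs_tendsto_zero _).2 (hsq.congr fun d => ?_)
  rw [Function.comp_apply, ← Real.sqrt_sq_eq_abs, div_pow, Real.sq_sqrt (by positivity),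
    div_div_eq_mul_div]
  congr 1
  ring

end Rates

namespace IsAxisWalkModel

variable {Ω₀ Ω : Type*} [MeasurableSpace Ω₀] [MeasurableSpace Ω] {P₀ : Measure Ω₀} {P : Measure Ω}
  {R₀ : Ω₀ → ℝ} {R : ℕ → Ω → ℝ}
  {V : (d : ℕ) → ℕ → Ω → EuclideanSpace ℝ (Fin d)} {n : ℕ → ℕ}

lemma aemeasurable_norm_sq_axisWalk_sub_div (h : IsAxisWalkModel P₀ P R₀ R V) (c : ℕ → ℝ) (d : ℕ) :
    AEMeasurable (fun ω => (‖axisWalk R V d (n d) ω‖ ^ 2 - n d) / c d) P := by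
  have := h.measurable_axisWalk d (n d)
  fun_prop

lemma integral_sq_sub_one_sq_map (h : IsAxisWalkModel P₀ P R₀ R V) :
    ∫ x, (x ^ 2 - 1) ^ 2 ∂(P₀.map R₀) = variance (fun ω => R₀ ω ^ 2) P₀ := by
  rw [variance_eq_integral (h.aemeasurable.pow_const 2), h.second_moment,
    integral_map h.aemeasurable (by fun_prop)]

variable [IsProbabilityMeasure P]

lemma convergesInLaw_sum_quadraticIncrement (h : IsAxisWalkModel P₀ P R₀ R V)
    (hn : Tendsto n atTop atTop) {a b : ℕ → ℝ} {A B : ℝ} (hb0 : Tendsto b atTop (𝓝 0))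
    (ha : Tendsto (fun d => n d * a d ^ 2) atTop (𝓝 A))
    (hb : Tendsto (fun d : ℕ => (n d : ℝ) ^ 2 * b d ^ 2 / d) atTop (𝓝 B)) {g : ℝ → ℝ}
    (hg : Measurable g) (hg2 : MemLp g 2 (P₀.map R₀)) (hg0 : ∫ x, g x ∂(P₀.map R₀) = 0) :
    ConvergesInLaw P (fun d ω => ∑ k ∈ Finset.range (n d),
        quadraticIncrement (a d) (b d) (fun j ω => g (R j ω)) R (V d) k ω)
      (gaussianReal 0 (A * (∫ x, g x ^ 2 ∂(P₀.map R₀)) + B / 2).toNNReal) := by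
  have hR := h.measurable_R
  have hV := h.measurable_V
  have hA : 0 ≤ A := ge_of_tendsto' ha fun d => by positivity
  have hB : 0 ≤ B := ge_of_tendsto' hb fun d => by positivity
  refine convergesInLaw_of_tendsto_charFun (fun d => ?_) fun t => ?_
  · unfold quadraticIncrement collisionSum weightedWalk
    fun_prop
  · have hlim := tendsto_integral_exp_mul_sum_quadraticIncrement (R := fun _ => R) (V := V)
      (d := id) ((eventually_ne_atTop 0).mono fun d hd => h.isAxisNoise hd) hn tendsto_id hb0 ha hb
      hg hg2 hg0 measurable_id h.memLp_id_map h.integral_id_map t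
    rw [h.integral_id_sq_map] at hlim
    have hvar : 0 ≤ A * (∫ x, g x ^ 2 ∂(P₀.map R₀)) + B / 2 :=
      add_nonneg (mul_nonneg hA (integral_nonneg fun x => sq_nonneg (g x))) (by positivity)
    rw [charFun_gaussianReal, Real.coe_toNNReal _ hvar]
    convert! hlim using 2
    push_cast
    congr 1
    ring

lemma integral_sq_sub_one_map (h : IsAxisWalkModel P₀ P R₀ R V) :
    ∫ x, (x ^ 2 - 1) ∂(P₀.map R₀) = 0 := by
  have := (h.isAxisNoise one_ne_zero).isProbabilityMeasure
  have hsq : Integrable (fun x => x ^ 2) (P₀.map R₀) := h.memLp_id_map.integrable_sq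
  have hone : ∫ x, x ^ 2 ∂(P₀.map R₀) = 1 := h.integral_id_sq_map
  rw [integral_sub hsq (integrable_const 1), hone]
  simp

lemma memLp_sq_sub_one_map (h : IsAxisWalkModel P₀ P R₀ R V)
    (h4 : Integrable (fun ω => R₀ ω ^ 4) P₀) : MemLp (fun x => x ^ 2 - 1) 2 (P₀.map R₀) := by
  have := (h.isAxisNoise one_ne_zero).isProbabilityMeasure
  have hsq : MemLp (fun x => x ^ 2) 2 (P₀.map R₀) := by
    rw [memLp_two_iff_integrable_sq (by fun_prop), integrable_map_measure (by fun_prop)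
      h.aemeasurable]
    refine h4.congr (ae_of_all _ fun ω => ?_)
    simp only [Function.comp_apply]
    ring
  exact hsq.sub (memLp_const 1)

lemma convergesInLaw_norm_sq_axisWalk_sub_div (h : IsAxisWalkModel P₀ P R₀ R V)
    (h4 : Integrable (fun ω => R₀ ω ^ 4) P₀) (hn : Tendsto n atTop atTop) {c : ℕ → ℝ} {A B : ℝ}
    (hc : Tendsto c atTop atTop) (hA : Tendsto (fun d => n d / c d ^ 2) atTop (𝓝 A))
    (hB : Tendsto (fun d : ℕ => (n d : ℝ) ^ 2 / c d ^ 2 / d) atTop (𝓝 B)) :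
    ConvergesInLaw P (fun d ω => (‖axisWalk R V d (n d) ω‖ ^ 2 - n d) / c d)
      (gaussianReal 0 (A * variance (fun ω => R₀ ω ^ 2) P₀ + 2 * B).toNNReal) := by
  have hclt := h.convergesInLaw_sum_quadraticIncrement hn (a := fun d => 1 / c d)
    (b := fun d => 2 / c d) (B := 4 * B) (hc.const_div_atTop 2)
    (hA.congr fun d => by ring) ((hB.const_mul 4).congr fun d => by ring)
    (by fun_prop) (h.memLp_sq_sub_one_map h4) h.integral_sq_sub_one_map
  rw [h.integral_sq_sub_one_sq_map, show 4 * B / 2 = 2 * B by ring] at hclt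
  refine hclt.congr' (h.aemeasurable_norm_sq_axisWalk_sub_div c) ?_
  filter_upwards [eventually_ne_atTop 0] with d hd
  filter_upwards [h.ae_norm_sq_axisWalk_sub hd (n d)] with ω hω
  simp only [hω, quadraticIncrement, Finset.sum_add_distrib, ← Finset.mul_sum]
  ring

lemma convergesInLaw_div_sqrt (h : IsAxisWalkModel P₀ P R₀ R V)
    (h4 : Integrable (fun ω => R₀ ω ^ 4) P₀) (hn : Tendsto n atTop atTop) {γ : ℝ}
    (hγ : Tendsto (fun d : ℕ => (n d : ℝ) / d) atTop (𝓝 γ)) :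
    ConvergesInLaw P (fun d ω => (‖axisWalk R V d (n d) ω‖ ^ 2 - n d) / √(n d : ℝ))
      (gaussianReal 0 (2 * γ + variance (fun ω => R₀ ω ^ 2) P₀).toNNReal) := by
  have hnr : Tendsto (fun d => (n d : ℝ)) atTop atTop := tendsto_natCast_atTop_atTop.comp hn
  have hclt := h.convergesInLaw_norm_sq_axisWalk_sub_div h4 hn (c := fun d => √(n d : ℝ)) (A := 1)
    (B := γ) (Real.tendsto_sqrt_atTop.comp hnr) ?_ ?_
  · simpa only [one_mul, add_comm] using hclt
  · refine tendsto_const_nhds.congr' ?_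
    filter_upwards [hnr.eventually_gt_atTop 0] with d hd
    rw [Real.sq_sqrt hd.le, div_self hd.ne']
  · refine hγ.congr' ?_
    filter_upwards [hnr.eventually_gt_atTop 0] with d hd
    rw [Real.sq_sqrt hd.le, sq, mul_div_cancel_right₀ _ hd.ne']

lemma convergesInLaw_div_sqrt_two_mul_sq_div (h : IsAxisWalkModel P₀ P R₀ R V)
    (h4 : Integrable (fun ω => R₀ ω ^ 4) P₀) (hn : Tendsto n atTop atTop)
    (hnd : Tendsto (fun d : ℕ => (n d : ℝ) / d) atTop atTop) :
    ConvergesInLaw P (fun d ω => (‖axisWalk R V d (n d) ω‖ ^ 2 - n d) / √(2 * (n d : ℝ) ^ 2 / d))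
      (gaussianReal 0 1) := by
  have hnr : Tendsto (fun d => (n d : ℝ)) atTop atTop := tendsto_natCast_atTop_atTop.comp hn
  have hsq : Tendsto (fun d : ℕ => (n d : ℝ) ^ 2 / d) atTop atTop :=
    (hnr.atTop_mul_atTop₀ hnd).congr fun d => by ring
  have hclt := h.convergesInLaw_norm_sq_axisWalk_sub_div h4 hn (A := 0)
    (tendsto_sqrt_two_mul_atTop hsq) ?_ (tendsto_sq_div_sqrt_two_mul_sq_div hnr)
  · simpa using hclt
  · refine (hnd.const_div_atTop (1 / 2)).congr' ?_
    filter_upwards [hnr.eventually_gt_atTop 0] with d hd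
    rw [Real.sq_sqrt (by positivity)]
    field_simp

lemma convergesInLaw_gaussianReal_of_slowlyVarying (h : IsAxisWalkModel P₀ P R₀ R V)
    (hn : Tendsto n atTop atTop) {α δ : ℝ} {L : ℝ → ℝ} {ζ : Measure ℝ} [IsProbabilityMeasure ζ]
    (hα : 1 < α) (hL : IsSlowlyVarying L)
    (hconv : ConvergesInLaw P
      (fun m ω => ((∑ i ∈ Finset.range m, R i ω ^ 2) - m) / ((m : ℝ) ^ (1 / α) * L m)) ζ)
    (hδ : 0 < δ) (hlt : ∀ᶠ d : ℕ in atTop, (d : ℝ) ^ (α / (2 * α - 2) + δ) < n d) :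
    ConvergesInLaw P (fun d ω => (‖axisWalk R V d (n d) ω‖ ^ 2 - n d) / √(2 * (n d : ℝ) ^ 2 / d))
      (gaussianReal 0 1) := by
  have hnr : Tendsto (fun d => (n d : ℝ)) atTop atTop := tendsto_natCast_atTop_atTop.comp hn
  set s : ℕ → ℝ := fun d => √(2 * (n d : ℝ) ^ 2 / d)
  have hs_top : Tendsto s atTop atTop := tendsto_sqrt_two_mul_atTop
    (tendsto_sq_div_atTop_of_rpow_lt hα hδ tendsto_natCast_atTop_atTop hlt)
  have hcollision := h.convergesInLaw_sum_quadraticIncrement hn (a := 0) (A := 0)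
    (B := 4 * (1 / 2))
    (hs_top.const_div_atTop 2) (by simp)
    (((tendsto_sq_div_sqrt_two_mul_sq_div hnr).const_mul 4).congr fun d => by ring)
    measurable_zero MemLp.zero (by simp)
  have hlaw : (0 * ∫ x, (0 : ℝ → ℝ) x ^ 2 ∂(P₀.map R₀) + 4 * (1 / 2) / 2).toNNReal = 1 := by
    norm_num
  simp only [hlaw] at hcollision
  refine hcollision.add_tendstoInMeasure_zero (h.aemeasurable_norm_sq_axisWalk_sub_div s)
    ((hconv.comp hn).tendstoInMeasure_mul
      (hL.tendsto_rpow_mul_div_sqrt_zero hα hδ hnr hlt)) ?_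
  filter_upwards [eventually_ne_atTop 0, hnr.eventually_gt_atTop 0,
    hnr.eventually hL.eventually_pos]
    with d hd hnd hLd
  filter_upwards [h.ae_norm_sq_axisWalk_sub hd (n d)] with ω hω
  have hscale : (n d : ℝ) ^ (1 / α) * L (n d) ≠ 0 := by positivity
  simp only [Pi.add_apply, hω, quadraticIncrement, ← Finset.mul_sum, Pi.zero_apply, zero_mul,
    zero_add, div_mul_div_cancel₀' hscale, Finset.sum_sub_distrib, Finset.sum_const,
    Finset.card_range, nsmul_eq_mul, mul_one]
  ring

lemma memLp_sum_mul_collisionSum (h : IsAxisWalkModel P₀ P R₀ R V) {d : ℕ} (hd : d ≠ 0) (m : ℕ) :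
    MemLp (fun ω => ∑ k ∈ Finset.range m, R k ω * collisionSum R (V d) k ω) 2 P :=
  memLp_finsetSum _ fun k _ => (h.isAxisNoise hd).memLp_comp_mul_collisionSum two_ne_zero
    measurable_id h.memLp_id_map measurable_id h.memLp_id_map k

lemma integral_sum_mul_collisionSum_sq_le (h : IsAxisWalkModel P₀ P R₀ R V) {d : ℕ} (hd : d ≠ 0)
    (m : ℕ) : ∫ ω, (∑ k ∈ Finset.range m, R k ω * collisionSum R (V d) k ω) ^ 2 ∂P ≤
      (m : ℝ) ^ 2 / (2 * d) := by
  have hle := (h.isAxisNoise hd).integral_sum_comp_mul_collisionSum_sq_le measurable_id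
    h.memLp_id_map h.integral_id_map measurable_id h.memLp_id_map h.integral_id_map m
  rwa [h.integral_id_sq_map, one_mul, one_mul] at hle

lemma convergesInLaw_stable_of_slowlyVarying (h : IsAxisWalkModel P₀ P R₀ R V)
    (hn : Tendsto n atTop atTop) {α δ : ℝ} {L : ℝ → ℝ} {ζ : Measure ℝ} [IsProbabilityMeasure ζ]
    (hα : 1 < α) (hL : IsSlowlyVarying L)
    (hconv : ConvergesInLaw P
      (fun m ω => ((∑ i ∈ Finset.range m, R i ω ^ 2) - m) / ((m : ℝ) ^ (1 / α) * L m)) ζ)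
    (hδ : 0 < δ) (hlt : ∀ᶠ d : ℕ in atTop, (n d : ℝ) < (d : ℝ) ^ (α / (2 * α - 2) - δ)) :
    ConvergesInLaw P
      (fun d ω => (‖axisWalk R V d (n d) ω‖ ^ 2 - n d) / ((n d : ℝ) ^ (1 / α) * L (n d))) ζ := by
  have hnr : Tendsto (fun d => (n d : ℝ)) atTop atTop := tendsto_natCast_atTop_atTop.comp hn
  set c : ℕ → ℝ := fun d => (n d : ℝ) ^ (1 / α) * L (n d) with hc
  have hrate : Tendsto (fun d : ℕ => (2 / c d) ^ 2 * ((n d : ℝ) ^ 2 / (2 * d))) atTop (𝓝 0) :=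
    ((hL.tendsto_mul_sq_div_sq_atTop hα hδ hnr tendsto_natCast_atTop_atTop
      hlt).const_div_atTop 2).congr fun d => by
        rw [div_div_eq_mul_div]
        ring
  have hcollision : TendstoInMeasure P (fun d ω => 2 / c d *
      ∑ k ∈ Finset.range (n d), R k ω * collisionSum R (V d) k ω) atTop 0 := by
    refine tendstoInMeasure_zero_of_integral_sq ?_ (squeeze_zero'
      (Eventually.of_forall fun d => integral_nonneg fun ω => sq_nonneg _) ?_ hrate)
    · filter_upwards [eventually_ne_atTop 0] with d hd
      exact (h.memLp_sum_mul_collisionSum hd (n d)).const_mul _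
    · filter_upwards [eventually_ne_atTop 0] with d hd
      simp only [mul_pow]
      rw [integral_const_mul]
      exact mul_le_mul_of_nonneg_left (h.integral_sum_mul_collisionSum_sq_le hd (n d)) (sq_nonneg _)
  refine (hconv.comp hn).add_tendstoInMeasure_zero (h.aemeasurable_norm_sq_axisWalk_sub_div c)
    hcollision ?_
  filter_upwards [eventually_ne_atTop 0] with d hd
  filter_upwards [h.ae_norm_sq_axisWalk_sub hd (n d)] with ω hω
  simp only [Pi.add_apply, hω, hc, Finset.sum_sub_distrib, Finset.sum_const, Finset.card_range,
    nsmul_eq_mul, mul_one]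
  ring

end IsAxisWalkModel

end

theorem mainTheorem11_general {Ω₀ Ω : Type*} [MeasurableSpace Ω₀] [MeasurableSpace Ω]
    (P₀ : Measure Ω₀) (P : Measure Ω) [IsProbabilityMeasure P]
    (R₀ : Ω₀ → ℝ) (R : ℕ → Ω → ℝ) (V : (d : ℕ) → ℕ → Ω → EuclideanSpace ℝ (Fin d))
    (hmodel : IsAxisWalkModel P₀ P R₀ R V)
    (n : ℕ → ℕ) (hn : Tendsto n atTop atTop) :
    (Integrable (fun ω => R₀ ω ^ 4) P₀ →
      (Tendsto (fun d : ℕ => (n d : ℝ) / d) atTop (𝓝 0) →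
        ConvergesInLaw P
          (fun d ω => (‖axisWalk R V d (n d) ω‖ ^ 2 - n d) / √(n d : ℝ))
          (gaussianReal 0 (variance (fun ω => R₀ ω ^ 2) P₀).toNNReal)) ∧
      (Tendsto (fun d : ℕ => (n d : ℝ) / d) atTop atTop →
        ConvergesInLaw P
          (fun d ω => (‖axisWalk R V d (n d) ω‖ ^ 2 - n d) / √(2 * (n d : ℝ) ^ 2 / d))
          (gaussianReal 0 1)) ∧
      (∀ γ : ℝ, 0 < γ → (fun d : ℕ => (n d : ℝ)) ~[atTop] (fun d : ℕ => γ * (d : ℝ)) →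
        ConvergesInLaw P
          (fun d ω => (‖axisWalk R V d (n d) ω‖ ^ 2 - n d) / √(n d : ℝ))
          (gaussianReal 0 (2 * γ + variance (fun ω => R₀ ω ^ 2) P₀).toNNReal))) ∧
    (∀ (α : ℝ) (L : ℝ → ℝ) (ζ : Measure ℝ) [IsProbabilityMeasure ζ],
      1 < α → IsSlowlyVarying L →
      ConvergesInLaw P
        (fun m ω => ((∑ i ∈ Finset.range m, R i ω ^ 2) - m) / ((m : ℝ) ^ (1 / α) * L m)) ζ →
      ((∃ δ : ℝ, 0 < δ ∧ ∀ᶠ d : ℕ in atTop, (d : ℝ) ^ (α / (2 * α - 2) + δ) < n d) →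
        ConvergesInLaw P
          (fun d ω => (‖axisWalk R V d (n d) ω‖ ^ 2 - n d) / √(2 * (n d : ℝ) ^ 2 / d))
          (gaussianReal 0 1)) ∧
      ((∃ δ : ℝ, 0 < δ ∧ ∀ᶠ d : ℕ in atTop, (n d : ℝ) < (d : ℝ) ^ (α / (2 * α - 2) - δ)) →
        ConvergesInLaw P
          (fun d ω => (‖axisWalk R V d (n d) ω‖ ^ 2 - n d) /
            ((n d : ℝ) ^ (1 / α) * L (n d))) ζ)) := by
  refine ⟨fun h4 => ⟨fun hnd => ?_, hmodel.convergesInLaw_div_sqrt_two_mul_sq_div h4 hn,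
      fun γ _ hγ => ?_⟩,
    fun α L ζ _ hα hL hconv =>
      ⟨fun ⟨_, hδ, hlt⟩ =>
        hmodel.convergesInLaw_gaussianReal_of_slowlyVarying hn hα hL hconv hδ hlt,
      fun ⟨_, hδ, hlt⟩ => hmodel.convergesInLaw_stable_of_slowlyVarying hn hα hL hconv hδ hlt⟩⟩
  · simpa only [mul_zero, zero_add] using hmodel.convergesInLaw_div_sqrt h4 hn hnd
  · refine hmodel.convergesInLaw_div_sqrt h4 hn
      ((hγ.div (IsEquivalent.refl (u := fun d : ℕ => (d : ℝ)))).congr_right ?_).tendsto_const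
    filter_upwards [eventually_ne_atTop 0] with d hd
    exact mul_div_cancel_right₀ γ (Nat.cast_ne_zero.2 hd)

theorem mainTheorem11 {Ω₀ Ω : Type*} [MeasurableSpace Ω₀] [MeasurableSpace Ω]
    (P₀ : Measure Ω₀) [IsProbabilityMeasure P₀] (P : Measure Ω) [IsProbabilityMeasure P]
    (R₀ : Ω₀ → ℝ) (R : ℕ → Ω → ℝ) (V : (d : ℕ) → ℕ → Ω → EuclideanSpace ℝ (Fin d))
    (hmodel : IsAxisWalkModel P₀ P R₀ R V)
    (n : ℕ → ℕ) (hn : Tendsto n atTop atTop) :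
    -- the case of a finite fourth moment
    (Integrable (fun ω => R₀ ω ^ 4) P₀ →
      (Tendsto (fun d : ℕ => (n d : ℝ) / d) atTop (𝓝 0) →
        ConvergesInLaw P
          (fun d ω => (‖axisWalk R V d (n d) ω‖ ^ 2 - n d) / √(n d : ℝ))
          (gaussianReal 0 (variance (fun ω => R₀ ω ^ 2) P₀).toNNReal)) ∧
      (Tendsto (fun d : ℕ => (n d : ℝ) / d) atTop atTop →
        ConvergesInLaw P
          (fun d ω => (‖axisWalk R V d (n d) ω‖ ^ 2 - n d) / √(2 * (n d : ℝ) ^ 2 / d))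
          (gaussianReal 0 1)) ∧
      (∀ γ : ℝ, 0 < γ → (fun d : ℕ => (n d : ℝ)) ~[atTop] (fun d : ℕ => γ * (d : ℝ)) →
        ConvergesInLaw P
          (fun d ω => (‖axisWalk R V d (n d) ω‖ ^ 2 - n d) / √(n d : ℝ))
          (gaussianReal 0 (2 * γ + variance (fun ω => R₀ ω ^ 2) P₀).toNNReal))) ∧
    -- the case of `R²` in the domain of attraction of a stable law
    (∀ (α : ℝ) (L : ℝ → ℝ) (ζ : Measure ℝ) [IsProbabilityMeasure ζ],
      1 < α → α < 2 → IsSlowlyVarying L → IsCenteredSpectrallyPositiveStable α ζ →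
      ConvergesInLaw P
        (fun m ω => ((∑ i ∈ Finset.range m, R i ω ^ 2) - m) / ((m : ℝ) ^ (1 / α) * L m)) ζ →
      ((∃ δ : ℝ, 0 < δ ∧ ∀ᶠ d : ℕ in atTop, (d : ℝ) ^ (α / (2 * α - 2) + δ) < n d) →
        ConvergesInLaw P
          (fun d ω => (‖axisWalk R V d (n d) ω‖ ^ 2 - n d) / √(2 * (n d : ℝ) ^ 2 / d))
          (gaussianReal 0 1)) ∧
      ((∃ δ : ℝ, 0 < δ ∧ ∀ᶠ d : ℕ in atTop, (n d : ℝ) < (d : ℝ) ^ (α / (2 * α - 2) - δ)) →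
        ConvergesInLaw P
          (fun d ω => (‖axisWalk R V d (n d) ω‖ ^ 2 - n d) /
            ((n d : ℝ) ^ (1 / α) * L (n d))) ζ)) :=
  have hgen := mainTheorem11_general P₀ P R₀ R V hmodel n hn
  ⟨hgen.1, fun α L ζ _ hα _ hL _ => hgen.2 α L ζ hα hL⟩
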